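/- Fix $0<p<1$. For a graph $H$ with $r$ vertices and $m$ edges and $\epsilon>0$, say that a finite graph $G$ with $n$ vertices satisfies $\mathcal{P}^*_{H,p}(\epsilon)$ if for every subset $S\subseteq V(G)$ the number of labeled copies of $H$ in the induced subgraph $G[S]$ (that is, the number of injective maps $V(H)\to S$ sending edges of $H$ to edges of $G$) is within $\epsilon n^r$ of $p^m|S|^r$. Write $\mathcal{P}^*_{2,p}(\epsilon)$ for $\mathcal{P}^*_{K_2,p}(\epsilon)$; since an edge gives two labeled copies of $K_2$, it says that every $S\subseteq V(G)$ satisfies $\big|2e(G[S])-p|S|^2\big|\le\epsilon n^2$. Theorem. For every $0<p<1$ and every natural number $r\ge 3$, there are constants $c=c(p,r)>0$ and $c'=c'(p,r)>0$ such that the following holds. If $H$ is a graph with $r$ vertices and at least one edge, $0<\epsilon<1/2$, and a finite graph $G$ satisfies $\mathcal{P}^*_{H,p}(\delta)$ with $\delta=c'\epsilon^{c}$, then $G$ also satisfies $\mathcal{P}^*_{2,p}(\epsilon)$. -/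

import Mathlib

/-- The hereditary copy-count property of `G` with respect to a fixed graph `H` on `r` vertices with
`m` edges, with density `p` and error `ε`: for every set `S` of vertices of the `n`-vertex graph
`G`, the number of labelled copies of `H` in the induced subgraph `G[S]` (that is, of injective
homomorphisms from `H` to `G[S]`) is within `ε * n ^ r` of `p ^ m * |S| ^ r`. -/
def HereditaryCopyCount {W V : Type*} [Fintype W] [Fintype V]
    (H : SimpleGraph W) (G : SimpleGraph V) (p ε : ℝ) : Prop :=
  ∀ S : Finset V,
    |((G.induce (S : Set V)).labelledCopyCount H : ℝ)
        - p ^ H.edgeSet.ncard * (S.card : ℝ) ^ Fintype.card W|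
      ≤ ε * (Fintype.card V : ℝ) ^ Fintype.card W

/-!
Write `A` for the adjacency matrix of `G`, `T = A - p`, and average over the vertices instead of
summing. The hypothesis is first polarized (`exists_symmetricCount`): for all weights `u w` with
values in `[-1, 1]`, the density of `H` in `A` weighted by `u w` at the vertex `w`, summed over all
relabellings of `H`, is within `δ` of its value for the constant matrix `p`. Maps that are not
injective only matter up to `O(1 / n)`, and `1 / n` is at most a power of the error because a single
vertex spans no copy of `H`. The conclusion says that the bilinear form of `T` is small on bounded
functions. The proof has a qualitative and a quantitative half.

Qualitative half (`exists_forall_abs_pairing_le`): a small enough `δ` makes the form of `T` smaller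
than any given constant. Otherwise, density increments produce arbitrarily long tuples of weights
that are pairwise regular, one pair having density far from `p`; by the counting lemma, the matrix
of densities satisfies the polarized hypothesis on all tuples of distinct indices, approximately. An
ultralimit gives an infinite matrix satisfying it exactly. A second ultralimit adds points at
infinity, whose mutual entry `q` must satisfy `q ^ m = p ^ m`, so `q = p`. Moving one vertex of `H`,
and then two, from infinity to given indices shows that all entries are `p`
(`eq_of_countDefect_eq_zero`).

Quantitative half (`exists_abs_pairing_le_of_abs_pairing_le`): let `ε`, at most a small constant, be
the supremum of the form of `T`. The density of copies of `H` through a vertex `x` is, up to `O(ε)`,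
a strictly increasing function of the degree of `x`, so `T` maps bounded functions to functions
whose square has mean at most `κ = O(δ + ε ^ 2)` (`exists_expect_sq_le`). Now expand `A = p + T` in
the polarized hypothesis. The density in `T` of a graph with two non-adjacent non-isolated vertices
is at most `κ` by the Cauchy-Schwarz inequality, so besides single edges only cliques with at least
three vertices are left. They are eliminated by using the functions `T(y, ·)` as weights on a set
`I` of vertices and averaging over `y`: this joins a new vertex to `I`, and afterwards the clique on
`I` is the only graph without two non-adjacent non-isolated vertices. Hence the terms of single
edges are `O(δ + κ)` on their own, which gives `ε = O(δ + ε ^ 2)` and therefore `ε = O(δ)`.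
-/

namespace HereditaryCounts

open Finset Function Filter Topology
open scoped BigOperators

set_option linter.unusedSectionVars false

universe u v

variable {V : Type u} {W : Type v} [Fintype V] [Fintype W] [DecidableEq W]

/-! ### Averages over maps -/

/-- Resampling one coordinate of a uniformly random map does not change an average. -/
lemma expect_update (i : W) (F : (W → V) → ℝ) :
    𝔼 φ, F φ = 𝔼 φ : W → V, 𝔼 x, F (update φ i x) := by
  rcases isEmpty_or_nonempty V with hV | hV
  · have : IsEmpty (W → V) := ⟨fun φ => hV.elim (φ i)⟩
    simp
  have h1 : 𝔼 z : (W → V) × V, F (update z.1 i z.2) = 𝔼 z : (W → V) × V, F z.1 := by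
    -- the involution exchanging the `i`-th coordinate with the fresh sample
    refine Finset.expect_nbij' (fun z => (update z.1 i z.2, z.1 i))
      (fun z => (update z.1 i z.2, z.1 i)) ?_ ?_ ?_ ?_ ?_ <;> simp
  rw [← univ_product_univ, expect_product, expect_product] at h1
  simpa using h1.symm

lemma expect_prod (u : W → V → ℝ) :
    𝔼 φ : W → V, ∏ w, u w (φ w) = ∏ w, 𝔼 x, u w x := by
  simp only [Fintype.expect_eq_sum_div_card, Finset.prod_div_distrib, Fintype.card_fun,
    Finset.prod_const, Finset.card_univ, Nat.cast_pow]
  rw [Finset.prod_univ_sum, Fintype.piFinset_univ]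

lemma expect_prod_subset [Nonempty V] (s : Finset W) (u : W → V → ℝ) :
    𝔼 φ : W → V, ∏ w ∈ s, u w (φ w) = ∏ w ∈ s, 𝔼 x, u w x := by
  have h := expect_prod (V := V) (fun w x => if w ∈ s then u w x else 1)
  simp only [Finset.prod_ite_mem, Finset.univ_inter] at h
  rw [h, ← Finset.prod_subset (Finset.subset_univ s)]
  · exact Finset.prod_congr rfl fun w hw => by simp [hw]
  · intro w _ hw
    simp [hw]

/-! ### Weighted homomorphism densities -/

/-- The bilinear form `𝔼 x, 𝔼 y, K(x, y) f(x) g(y)` of a symmetric kernel `K`. -/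
noncomputable def pairing (K : Sym2 V → ℝ) (f g : V → ℝ) : ℝ :=
  𝔼 x, 𝔼 y, K s(x, y) * (f x * g y)

lemma pairing_comm (K : Sym2 V → ℝ) (f g : V → ℝ) : pairing K f g = pairing K g f := by
  rw [pairing, pairing, expect_comm]
  refine expect_congr rfl fun x _ => expect_congr rfl fun y _ => ?_
  rw [Sym2.eq_swap, mul_comm (f y)]

/-- The contribution of a map `φ` to the homomorphism density of the graph with edge set `E` into
the kernel `K`, with a weight function `u w` at each vertex `w`. -/
noncomputable def weightedHom (K : Sym2 V → ℝ) (u : W → V → ℝ) (E : Finset (Sym2 W))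
    (φ : W → V) : ℝ :=
  (∏ w, u w (φ w)) * ∏ e ∈ E, K (e.map φ)

/-- The factors of `weightedHom` that involve the vertex `i`. -/
noncomputable def starFactor (K : Sym2 V → ℝ) (u : W → V → ℝ) (E : Finset (Sym2 W)) (i : W)
    (φ : W → V) : ℝ :=
  u i (φ i) * ∏ e ∈ E with i ∈ e, K (e.map φ)

/-- The factors of `weightedHom` that involve neither `i` nor `j`. -/
noncomputable def restFactor (K : Sym2 V → ℝ) (u : W → V → ℝ) (E : Finset (Sym2 W)) (i j : W)
    (φ : W → V) : ℝ :=
  (∏ w ∈ (univ.erase i).erase j, u w (φ w)) * ∏ e ∈ E with i ∉ e ∧ j ∉ e, K (e.map φ)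

section Factors

variable {K : Sym2 V → ℝ} {u : W → V → ℝ} {E : Finset (Sym2 W)} {i j : W}

lemma sym2_map_update {α β : Type*} [DecidableEq α] {e : Sym2 α} {i : α} (h : i ∉ e) (φ : α → β)
    (x : β) :
    e.map (update φ i x) = e.map φ :=
  Sym2.map_congr fun w hw => update_of_ne (fun h' => h (by rwa [← h'])) _ _

lemma weightedHom_eq_mul (hij : i ≠ j) (hE : s(i, j) ∉ E) (φ : W → V) :
    weightedHom K u E φ =
      restFactor K u E i j φ * (starFactor K u E i φ * starFactor K u E j φ) := by
  have h1 : ∏ w, u w (φ w) = u i (φ i) * (u j (φ j) * ∏ w ∈ (univ.erase i).erase j, u w (φ w)) := by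
    rw [Finset.mul_prod_erase _ (fun w => u w (φ w)) (by simp [hij.symm]),
      Finset.mul_prod_erase _ (fun w => u w (φ w)) (by simp)]
  have h2 : ∏ e ∈ E, K (e.map φ) = (∏ e ∈ E with i ∈ e, K (e.map φ)) *
      ((∏ e ∈ E with j ∈ e, K (e.map φ)) * ∏ e ∈ E with i ∉ e ∧ j ∉ e, K (e.map φ)) := by
    rw [← Finset.prod_filter_mul_prod_filter_not E (fun e => i ∈ e)]
    congr 1
    rw [← Finset.prod_filter_mul_prod_filter_not (E.filter fun e => i ∉ e) (fun e => j ∈ e),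
      Finset.filter_filter, Finset.filter_filter]
    congr 2
    refine Finset.filter_congr fun e he => ⟨fun h => h.2, fun h => ⟨fun hi => ?_, h⟩⟩
    exact hE ((Sym2.mem_and_mem_iff hij).1 ⟨hi, h⟩ ▸ he)
  rw [weightedHom, restFactor, starFactor, starFactor, h1, h2]
  ring

lemma starFactor_update (hij : i ≠ j) (hE : s(i, j) ∉ E) (φ : W → V) (y : V) :
    starFactor K u E i (update φ j y) = starFactor K u E i φ := by
  unfold starFactor
  rw [update_of_ne hij]
  congr 1
  refine Finset.prod_congr rfl fun e he => ?_
  rw [Finset.mem_filter] at he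
  rw [sym2_map_update]
  exact fun hj => hE ((Sym2.mem_and_mem_iff hij).1 ⟨he.2, hj⟩ ▸ he.1)

lemma restFactor_update_left (φ : W → V) (x : V) :
    restFactor K u E i j (update φ i x) = restFactor K u E i j φ := by
  unfold restFactor
  congr 1
  · refine Finset.prod_congr rfl fun w hw => ?_
    rw [update_of_ne]
    simp at hw
    tauto
  · refine Finset.prod_congr rfl fun e he => ?_
    rw [Finset.mem_filter] at he
    rw [sym2_map_update he.2.1]

lemma restFactor_update_right (φ : W → V) (x : V) :
    restFactor K u E i j (update φ j x) = restFactor K u E i j φ := by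
  unfold restFactor
  congr 1
  · refine Finset.prod_congr rfl fun w hw => ?_
    rw [update_of_ne]
    simp at hw
    tauto
  · refine Finset.prod_congr rfl fun e he => ?_
    rw [Finset.mem_filter] at he
    rw [sym2_map_update he.2.2]

/-- If `i` and `j` are not adjacent, then for fixed positions of the other vertices the weighted
homomorphism density factors into a part depending on `i` and a part depending on `j`. -/
lemma expect_mul_weightedHom (hij : i ≠ j) (hE : s(i, j) ∉ E) (L : V → V → ℝ) :
    𝔼 φ, L (φ i) (φ j) * weightedHom K u E φ =
      𝔼 φ, restFactor K u E i j φ * 𝔼 x, 𝔼 y, L x y *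
        (starFactor K u E i (update φ i x) * starFactor K u E j (update φ j y)) := by
  rw [expect_update i]
  have h : ∀ x, 𝔼 φ : W → V, L (update φ i x i) (update φ i x j) *
        weightedHom K u E (update φ i x) =
      𝔼 φ, 𝔼 y, restFactor K u E i j φ * (L x y *
        (starFactor K u E i (update φ i x) * starFactor K u E j (update φ j y))) := by
    intro x
    rw [expect_update j]
    refine expect_congr rfl fun φ _ => expect_congr rfl fun y _ => ?_
    rw [weightedHom_eq_mul hij hE, update_comm hij.symm, restFactor_update_right,
      starFactor_update hij hE, restFactor_update_left, update_comm hij,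
      starFactor_update hij.symm (by rwa [Sym2.eq_swap]), update_self, update_of_ne hij.symm,
      update_self]
    ring
  rw [expect_comm]
  simp_rw [h]
  rw [expect_comm]
  simp_rw [← mul_expect]

end Factors

/-- The counting lemma: if on each edge of `E` the kernel `K` is close to a constant `q e`, tested
against all functions below the vertex weights, then the density of `E` in `K` is close to that
in `q`. -/
lemma abs_expect_weightedHom_sub_le [Nonempty V] {K : Sym2 V → ℝ} (hK0 : ∀ e, 0 ≤ K e)
    (hK1 : ∀ e, K e ≤ 1)
    {q : Sym2 W → ℝ} (hq0 : ∀ e, 0 ≤ q e) (hq1 : ∀ e, q e ≤ 1)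
    {u : W → V → ℝ} (hu : ∀ w x, 0 ≤ u w x) {s : W → ℝ} (hs : ∀ w, 𝔼 x, u w x ≤ s w)
    {κ : ℝ} (hκ : 0 ≤ κ) (E : Finset (Sym2 W)) (hE : ∀ e ∈ E, ¬ e.IsDiag)
    (h : ∀ i j, s(i, j) ∈ E → ∀ f g : V → ℝ, (∀ x, 0 ≤ f x) → (∀ x, f x ≤ u i x) →
      (∀ x, 0 ≤ g x) → (∀ x, g x ≤ u j x) →
        |pairing (fun e => K e - q s(i, j)) f g| ≤ κ * (s i * s j)) :
    |𝔼 φ, weightedHom K u E φ - (∏ e ∈ E, q e) * ∏ w, 𝔼 x, u w x| ≤ #E * κ * ∏ w, s w := by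
  have hs0 : ∀ w, 0 ≤ s w := fun w => (expect_nonneg fun x _ => hu w x).trans (hs w)
  induction E using Finset.induction_on with
  | empty => simp [weightedHom, expect_prod]
  | insert e E he ih =>
    have ih := ih (fun e he => hE e (mem_insert_of_mem he))
      (fun i j hij => h i j (mem_insert_of_mem hij))
    induction e using Sym2.ind with | _ i j =>
    have hij : i ≠ j := by simpa using hE _ (mem_insert_self _ _)
    have key : |𝔼 φ, (K s(φ i, φ j) - q s(i, j)) * weightedHom K u E φ| ≤ κ * ∏ w, s w := by
      rw [expect_mul_weightedHom hij he (fun x y => K s(x, y) - q s(i, j))]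
      have hrest : ∀ φ, 0 ≤ restFactor K u E i j φ ∧
          restFactor K u E i j φ ≤ ∏ w ∈ (univ.erase i).erase j, u w (φ w) := fun φ =>
        ⟨mul_nonneg (prod_nonneg fun w _ => hu _ _) (prod_nonneg fun e _ => hK0 _),
          mul_le_of_le_one_right (prod_nonneg fun w _ => hu _ _)
            (prod_le_one (fun e _ => hK0 _) fun e _ => hK1 _)⟩
      have hstar : ∀ k φ x, 0 ≤ starFactor K u E k (update φ k x) ∧
          starFactor K u E k (update φ k x) ≤ u k x := by
        intro k φ x
        refine ⟨mul_nonneg (hu _ _) (prod_nonneg fun e _ => hK0 _), ?_⟩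
        refine (mul_le_of_le_one_right (hu _ _)
          (prod_le_one (fun e _ => hK0 _) fun e _ => hK1 _)).trans ?_
        simp
      have hprod : ∏ w, s w = s i * (s j * ∏ w ∈ (univ.erase i).erase j, s w) := by
        rw [mul_prod_erase _ s (by simp [hij.symm]), mul_prod_erase _ s (by simp)]
      calc |𝔼 φ, restFactor K u E i j φ * 𝔼 x, 𝔼 y, (K s(x, y) - q s(i, j)) *
              (starFactor K u E i (update φ i x) * starFactor K u E j (update φ j y))|
          ≤ 𝔼 φ, |restFactor K u E i j φ * 𝔼 x, 𝔼 y, (K s(x, y) - q s(i, j)) *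
              (starFactor K u E i (update φ i x) * starFactor K u E j (update φ j y))| :=
            abs_expect_le _ _
        _ ≤ 𝔼 φ : W → V, (∏ w ∈ (univ.erase i).erase j, u w (φ w)) * (κ * (s i * s j)) := by
            refine expect_le_expect fun φ _ => ?_
            rw [abs_mul, abs_of_nonneg (hrest φ).1]
            refine mul_le_mul (hrest φ).2 ?_ (abs_nonneg _) (prod_nonneg fun w _ => hu _ _)
            exact h i j (mem_insert_self _ _) _ _ (fun x => (hstar i φ x).1)
              (fun x => (hstar i φ x).2) (fun x => (hstar j φ x).1) (fun x => (hstar j φ x).2)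
        _ ≤ (∏ w ∈ (univ.erase i).erase j, s w) * (κ * (s i * s j)) := by
            rw [← expect_mul, expect_prod_subset]
            refine mul_le_mul_of_nonneg_right (prod_le_prod (fun w _ =>
              expect_nonneg fun x _ => hu w x) fun w _ => hs w) ?_
            exact mul_nonneg hκ (mul_nonneg (hs0 _) (hs0 _))
        _ = κ * ∏ w, s w := by rw [hprod]; ring
    have hsplit : 𝔼 φ, weightedHom K u (insert s(i, j) E) φ -
          (∏ e ∈ insert s(i, j) E, q e) * ∏ w, 𝔼 x, u w x =
        𝔼 φ, (K s(φ i, φ j) - q s(i, j)) * weightedHom K u E φ + q s(i, j) *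
          (𝔼 φ, weightedHom K u E φ - (∏ e ∈ E, q e) * ∏ w, 𝔼 x, u w x) := by
      rw [mul_sub, mul_expect, prod_insert he]
      have : 𝔼 φ, weightedHom K u (insert s(i, j) E) φ =
          𝔼 φ, (K s(φ i, φ j) - q s(i, j)) * weightedHom K u E φ +
            𝔼 φ, q s(i, j) * weightedHom K u E φ := by
        rw [← expect_add_distrib]
        refine expect_congr rfl fun φ _ => ?_
        rw [weightedHom, weightedHom, prod_insert he, Sym2.map_mk]
        ring
      rw [this]
      ring
    rw [hsplit, card_insert_of_notMem he]
    refine (abs_add_le _ _).trans ?_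
    rw [abs_mul, abs_of_nonneg (hq0 _)]
    have := mul_le_of_le_one_left (abs_nonneg
      (𝔼 φ, weightedHom K u E φ - (∏ e ∈ E, q e) * ∏ w, 𝔼 x, u w x)) (hq1 s(i, j))
    push_cast
    linarith

/-! ### Graphs with two non-adjacent non-isolated vertices -/

lemma abs_expect_le_one {ι : Type*} [Fintype ι] {f : ι → ℝ} (hf : ∀ x, |f x| ≤ 1) :
    |𝔼 x, f x| ≤ 1 := by
  rcases isEmpty_or_nonempty ι with h | h
  · simp
  · exact (abs_expect_le _ _).trans (expect_le univ_nonempty fun x _ => hf x)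

lemma abs_prod_le_one {ι : Type*} (s : Finset ι) {f : ι → ℝ} (hf : ∀ x ∈ s, |f x| ≤ 1) :
    |∏ x ∈ s, f x| ≤ 1 := by
  rw [abs_prod]
  exact prod_le_one (fun x _ => abs_nonneg _) hf

lemma abs_mul_le_one {a b : ℝ} (ha : |a| ≤ 1) (hb : |b| ≤ 1) : |a * b| ≤ 1 := by
  rw [abs_mul]
  exact mul_le_one₀ ha (abs_nonneg _) hb

/-- If `T` maps bounded functions to functions of small `L²` norm, then integrating out a
non-isolated vertex `i` leaves a function of the other vertices of small `L²` norm. -/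
lemma expect_sq_expect_starFactor_le [Nonempty V] {T : Sym2 V → ℝ} (hT : ∀ e, |T e| ≤ 1)
    {κ : ℝ} (hκ : ∀ f : V → ℝ, (∀ x, |f x| ≤ 1) → 𝔼 x, (𝔼 y, T s(x, y) * f y) ^ 2 ≤ κ)
    {u : W → V → ℝ} (hu : ∀ w x, |u w x| ≤ 1) {F : Finset (Sym2 W)}
    {i z : W} (hiz : i ≠ z) (he : s(i, z) ∈ F) :
    𝔼 φ : W → V, (𝔼 x, starFactor T u F i (update φ i x)) ^ 2 ≤ κ := by
  rw [expect_update z]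
  refine expect_le univ_nonempty fun φ _ => ?_
  -- the factor at `i` with the edge `s(i, z)` removed no longer depends on the position of `z`
  let f : V → ℝ := fun x =>
    u i x * ∏ e ∈ (F.filter fun e => i ∈ e).erase s(i, z), T (e.map (update φ i x))
  have hf : ∀ x, |f x| ≤ 1 := fun x =>
    abs_mul_le_one (hu _ _) (abs_prod_le_one _ fun e _ => hT _)
  refine le_trans (le_of_eq ?_) (hκ f hf)
  refine expect_congr rfl fun y _ => ?_
  congr 1
  refine expect_congr rfl fun x _ => ?_
  have hmem : s(i, z) ∈ F.filter fun e => i ∈ e := by simp [he]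
  rw [starFactor, ← mul_prod_erase _ _ hmem, Sym2.map_mk, update_self,
    update_of_ne hiz.symm, update_self, Sym2.eq_swap, mul_left_comm]
  congr 2
  refine prod_congr rfl fun e he' => ?_
  simp only [mem_erase, mem_filter] at he'
  rw [update_comm hiz.symm, sym2_map_update]
  exact fun hz => he'.1 ((Sym2.mem_and_mem_iff hiz).1 ⟨he'.2.2, hz⟩)

lemma abs_expect_weightedHom_le_of_not_adj [Nonempty V] {T : Sym2 V → ℝ} (hT : ∀ e, |T e| ≤ 1)
    {κ : ℝ} (hκ : ∀ f : V → ℝ, (∀ x, |f x| ≤ 1) → 𝔼 x, (𝔼 y, T s(x, y) * f y) ^ 2 ≤ κ)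
    {u : W → V → ℝ} (hu : ∀ w x, |u w x| ≤ 1) {F : Finset (Sym2 W)}
    {i j i' j' : W} (hij : i ≠ j) (h : s(i, j) ∉ F) (hi : i ≠ i') (hi' : s(i, i') ∈ F)
    (hj : j ≠ j') (hj' : s(j, j') ∈ F) :
    |𝔼 φ, weightedHom T u F φ| ≤ κ := by
  have h1 := expect_mul_weightedHom (V := V) (K := T) (u := u) hij h (fun _ _ => 1)
  simp only [one_mul] at h1
  rw [h1]
  calc _ ≤ 𝔼 φ : W → V, |restFactor T u F i j φ * 𝔼 x, 𝔼 y,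
        (starFactor T u F i (update φ i x) * starFactor T u F j (update φ j y))| :=
        abs_expect_le _ _
    _ ≤ 𝔼 φ : W → V, ((1 / 2) * (𝔼 x, starFactor T u F i (update φ i x)) ^ 2 +
          (1 / 2) * (𝔼 x, starFactor T u F j (update φ j x)) ^ 2) := by
        refine expect_le_expect fun φ _ => ?_
        simp_rw [← mul_expect, ← expect_mul]
        have hR : |restFactor T u F i j φ| ≤ 1 :=
          abs_mul_le_one (abs_prod_le_one _ fun w _ => hu _ _) (abs_prod_le_one _ fun e _ => hT _)
        rw [abs_mul]
        refine (mul_le_of_le_one_left (abs_nonneg _) hR).trans ?_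
        rw [abs_le]
        constructor <;>
        nlinarith [sq_nonneg ((𝔼 x, starFactor T u F i (update φ i x)) +
            𝔼 x, starFactor T u F j (update φ j x)),
          sq_nonneg ((𝔼 x, starFactor T u F i (update φ i x)) -
            𝔼 x, starFactor T u F j (update φ j x))]
    _ ≤ κ := by
        rw [expect_add_distrib, ← mul_expect, ← mul_expect]
        have a1 := expect_sq_expect_starFactor_le hT hκ hu hi hi'
        have a2 := expect_sq_expect_starFactor_le hT hκ hu hj hj'
        linarith

/-! ### Control of degrees -/

/-- The symmetrised count property of a kernel `A` for the graph with edge set `E`: summed over all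
relabellings of the vertices, the density of `E` weighted by arbitrary functions with values in
`[-1, 1]` is within `δ` of what it would be if `A` were the constant `p`. -/
def SymmetricCount (E : Finset (Sym2 W)) (p δ : ℝ) (A : Sym2 V → ℝ) : Prop :=
  ∀ u : W → V → ℝ, (∀ w x, |u w x| ≤ 1) →
    |∑ σ : Equiv.Perm W, (𝔼 φ, weightedHom A u (E.image (Sym2.map σ)) φ -
      p ^ #E * ∏ w, 𝔼 x, u w x)| ≤ δ

/-- A sum of terms `y ^ d - 1` has no cancellation, hence is at least `y - 1` in absolute value
as soon as some exponent is positive. -/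
lemma abs_sub_one_le_abs_sum_pow_sub_one {ι : Type*} (s : Finset ι) (d : ι → ℕ) {y : ℝ}
    (hy : 0 ≤ y) (hd : ∃ k ∈ s, d k ≠ 0) : |y - 1| ≤ |∑ k ∈ s, (y ^ d k - 1)| := by
  obtain ⟨k, hk, hdk⟩ := hd
  rcases le_total 1 y with h | h
  · have h1 : ∀ k ∈ s, 0 ≤ y ^ d k - 1 := fun k _ => by linarith [one_le_pow₀ (n := d k) h]
    rw [abs_of_nonneg (by linarith), abs_of_nonneg (sum_nonneg h1)]
    refine le_trans ?_ (single_le_sum h1 hk)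
    linarith [le_self_pow₀ h hdk]
  · have h1 : ∀ k ∈ s, 0 ≤ -(y ^ d k - 1) := fun k _ => by linarith [pow_le_one₀ (n := d k) hy h]
    rw [abs_of_nonpos (by linarith), ← abs_neg, ← sum_neg_distrib, abs_of_nonneg (sum_nonneg h1)]
    refine le_trans ?_ (single_le_sum h1 hk)
    linarith [pow_le_of_le_one hy h hdk]

/-- The density of `E` with the vertex `a` placed at `x` and weight `g` on the other vertices: up
to the cut distance of `A` to `p`, it is a monomial in the weighted degree of `x`. -/
lemma exists_expect_weightedHom_eq [Nonempty V] {A : Sym2 V → ℝ} (hA0 : ∀ e, 0 ≤ A e)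
    (hA1 : ∀ e, A e ≤ 1)
    {p : ℝ} (hp0 : 0 < p) (hp1 : p ≤ 1) {ε : ℝ}
    (hε : ∀ f g : V → ℝ, (∀ x, |f x| ≤ 1) → (∀ x, |g x| ≤ 1) →
      |pairing (fun e => A e - p) f g| ≤ ε)
    {E : Finset (Sym2 W)} (hE : ∀ e ∈ E, ¬ e.IsDiag) (a : W)
    {g : V → ℝ} (hg0 : ∀ x, 0 < g x) (hg1 : ∀ x, g x ≤ 1) :
    ∃ Z : V → ℝ, (∀ h : V → ℝ, 𝔼 φ, weightedHom A (update (fun _ => g) a h) E φ =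
        𝔼 x, h x * Z x) ∧ (∀ x, |Z x| ≤ 1) ∧
      ∀ x, |Z x - p ^ #E * (𝔼 y, g y) ^ (Fintype.card W - 1) *
          ((𝔼 y, A s(x, y) * g y) / (p * 𝔼 y, g y)) ^ #{w | s(a, w) ∈ E}| ≤ #E * ε := by
  have hε0 : 0 ≤ ε := (abs_nonneg _).trans (hε 0 0 (by simp) (by simp))
  have hμ : 0 < 𝔼 y, g y := expect_pos (fun x _ => hg0 x) univ_nonempty
  let E' := E.filter fun e => a ∉ e
  let v : V → W → V → ℝ := fun x w y =>
    if w = a then 1 else if s(a, w) ∈ E then A s(x, y) * g y else g y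
  have hv0 : ∀ x w y, 0 ≤ v x w y := by
    intro x w y
    dsimp only [v]
    split_ifs
    · exact zero_le_one
    · exact mul_nonneg (hA0 _) (hg0 _).le
    · exact (hg0 _).le
  have hv1 : ∀ x w y, v x w y ≤ 1 := by
    intro x w y
    dsimp only [v]
    split_ifs
    · exact le_rfl
    · exact mul_le_one₀ (hA1 _) (hg0 _).le (hg1 _)
    · exact hg1 _
  have hbij : E.filter (fun e => a ∈ e) =
      ({w | s(a, w) ∈ E} : Finset W).image (fun w => s(a, w)) := by
    ext e
    simp only [mem_filter, mem_image, mem_univ, true_and]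
    constructor
    · rintro ⟨he, ha⟩
      obtain ⟨w, rfl⟩ := Sym2.mem_iff_exists.1 ha
      exact ⟨w, he, rfl⟩
    · rintro ⟨w, hw, rfl⟩
      exact ⟨hw, by simp⟩
  have hinj : Set.InjOn (fun w => s(a, w)) (({w | s(a, w) ∈ E} : Finset W) : Set W) := by
    intro w _ w' _ h
    exact Sym2.congr_right.1 h
  have hcard : #E = #E' + #{w | s(a, w) ∈ E} := by
    rw [← card_filter_add_card_filter_not (s := E) (fun e => a ∈ e), add_comm, hbij,
      card_image_of_injOn hinj]
  have ha : s(a, a) ∉ E := fun h => hE _ h (by simp)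
  refine ⟨fun x => 𝔼 φ, weightedHom A (v x) E' φ, fun h => ?_, fun x => ?_, fun x => ?_⟩
  · rw [expect_update a, expect_comm]
    refine expect_congr rfl fun x _ => ?_
    rw [mul_expect]
    refine expect_congr rfl fun φ _ => ?_
    have h1 : ∏ w, update (fun _ => g) a h w (update φ a x w) =
        h x * ∏ w ∈ univ.erase a, g (φ w) := by
      rw [← mul_prod_erase univ _ (mem_univ a), update_self, update_self]
      congr 1
      refine prod_congr rfl fun w hw => ?_
      rw [update_of_ne (by simpa using hw), update_of_ne (by simpa using hw)]
    have h2 : ∏ e ∈ E, A (e.map (update φ a x)) =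
        (∏ w with s(a, w) ∈ E, A s(x, φ w)) * ∏ e ∈ E', A (e.map φ) := by
      rw [← prod_filter_mul_prod_filter_not E (fun e => a ∈ e), hbij, prod_image hinj]
      congr 1
      · refine prod_congr rfl fun w hw => ?_
        have : w ≠ a := by
          rintro rfl
          simp at hw
          exact ha hw
        rw [Sym2.map_mk, update_self, update_of_ne this]
      · refine prod_congr rfl fun e he => ?_
        rw [sym2_map_update (by simpa using (mem_filter.1 he).2)]
    have h3 : ∏ w, v x w (φ w) =
        (∏ w with s(a, w) ∈ E, A s(x, φ w)) * ∏ w ∈ univ.erase a, g (φ w) := by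
      rw [← mul_prod_erase univ _ (mem_univ a), prod_filter, ← mul_prod_erase univ _ (mem_univ a),
        if_neg ha, one_mul, ← prod_mul_distrib]
      simp only [v, if_true, one_mul]
      refine prod_congr rfl fun w hw => ?_
      rw [if_neg (by simpa using hw)]
      split_ifs <;> simp
    rw [weightedHom, weightedHom, h1, h2, h3]
    ring
  · refine abs_expect_le_one fun φ => abs_mul_le_one (abs_prod_le_one _ fun w _ => ?_)
      (abs_prod_le_one _ fun e _ => ?_)
    · rw [abs_of_nonneg (hv0 _ _ _)]
      exact hv1 _ _ _
    · rw [abs_of_nonneg (hA0 _)]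
      exact hA1 _
  · have hle : ∀ w, 𝔼 y, v x w y ≤ 1 := fun w => expect_le univ_nonempty fun y _ => hv1 _ _ _
    have h1 := abs_expect_weightedHom_sub_le hA0 hA1 (q := fun _ : Sym2 W => p) (fun _ => hp0.le)
      (fun _ => hp1) (hv0 x) (s := fun _ => 1) hle hε0 E'
      (fun e he => hE e (mem_filter.1 he).1) (by
        intro i j _ f g' hf0 hf1 hg0' hg1'
        simp only [mul_one]
        refine hε f g' (fun y => ?_) (fun y => ?_)
        · rw [abs_of_nonneg (hf0 y)]
          exact (hf1 y).trans (hv1 _ _ _)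
        · rw [abs_of_nonneg (hg0' y)]
          exact (hg1' y).trans (hv1 _ _ _))
    simp only [prod_const, one_pow, mul_one] at h1
    have h2 : ∏ w, 𝔼 y, v x w y = (𝔼 y, g y) ^ (Fintype.card W - 1) *
        ((𝔼 y, A s(x, y) * g y) / 𝔼 y, g y) ^ #{w | s(a, w) ∈ E} := by
      have : ∀ w, 𝔼 y, v x w y = (if w = a then 1 else 𝔼 y, g y) *
          (if s(a, w) ∈ E then (𝔼 y, A s(x, y) * g y) / 𝔼 y, g y else 1) := by
        intro w
        dsimp only [v]
        by_cases hw : w = a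
        · subst hw
          simp [ha]
        · simp only [hw, if_false]
          split_ifs
          · field_simp
          · simp
      simp_rw [this]
      rw [prod_mul_distrib, ← prod_filter, prod_const, ← mul_prod_erase univ _ (mem_univ a),
        if_pos rfl, one_mul]
      congr 1
      rw [prod_congr rfl (g := fun _ => 𝔼 y, g y), prod_const, card_erase_of_mem (mem_univ a),
        card_univ]
      intro w hw
      rw [if_neg (by simpa using hw)]
    have h3 : p ^ #E * (𝔼 y, g y) ^ (Fintype.card W - 1) *
          ((𝔼 y, A s(x, y) * g y) / (p * 𝔼 y, g y)) ^ #{w | s(a, w) ∈ E} =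
        p ^ #E' * ∏ w, 𝔼 y, v x w y := by
      rw [h2, hcard, pow_add, mul_comm p, ← div_div, div_pow _ p]
      field_simp
    rw [h3]
    refine h1.trans (mul_le_mul_of_nonneg_right ?_ hε0)
    exact_mod_cast card_filter_le _ _

lemma card_image_perm (σ : Equiv.Perm W) (E : Finset (Sym2 W)) :
    #(E.image (Sym2.map σ)) = #E :=
  card_image_of_injective _ (Sym2.map.injective σ.injective)

lemma not_isDiag_of_mem_image_perm {σ : Equiv.Perm W} {E : Finset (Sym2 W)}
    (hE : ∀ e ∈ E, ¬ e.IsDiag) : ∀ e ∈ E.image (Sym2.map σ), ¬ e.IsDiag := by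
  intro e he
  obtain ⟨e, he', rfl⟩ := mem_image.1 he
  rw [Sym2.isDiag_map σ.injective]
  exact hE e he'

lemma exists_perm_mem_image {E : Finset (Sym2 W)} (hE : ∀ e ∈ E, ¬ e.IsDiag) (hne : E.Nonempty)
    {a b : W} (hab : a ≠ b) : ∃ σ : Equiv.Perm W, s(a, b) ∈ E.image (Sym2.map σ) := by
  obtain ⟨e, he⟩ := hne
  induction e using Sym2.ind with | _ i j =>
  have hij : i ≠ j := by simpa using hE _ he
  let τ := Equiv.swap i a
  have hτ : τ j ≠ a := fun h => hij (τ.injective ((Equiv.swap_apply_left i a).trans h.symm))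
  refine ⟨τ.trans (Equiv.swap (τ j) b), mem_image.2 ⟨_, he, ?_⟩⟩
  rw [Sym2.map_mk, Equiv.trans_apply, Equiv.trans_apply, Equiv.swap_apply_left]
  rw [Equiv.swap_apply_left, Equiv.swap_apply_of_ne_of_ne hτ.symm hab]

lemma expect_sq_le_of_half_le [Nonempty V] [Nonempty W] {E : Finset (Sym2 W)}
    (hE : ∀ e ∈ E, ¬ e.IsDiag) (hne : E.Nonempty)
    {p : ℝ} (hp0 : 0 < p) (hp1 : p ≤ 1) {A : Sym2 V → ℝ} (hA0 : ∀ e, 0 ≤ A e)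
    (hA1 : ∀ e, A e ≤ 1) {δ ε : ℝ} (hA : SymmetricCount E p δ A)
    (hε : ∀ f g : V → ℝ, (∀ x, |f x| ≤ 1) → (∀ x, |g x| ≤ 1) →
      |pairing (fun e => A e - p) f g| ≤ ε)
    {g : V → ℝ} (hg0 : ∀ x, 1 / 2 ≤ g x) (hg1 : ∀ x, g x ≤ 1) :
    (p ^ #E * (1 / 2) ^ (Fintype.card W - 1)) ^ 2 * 𝔼 x, (𝔼 y, (A s(x, y) - p) * g y) ^ 2 ≤
      4 * Fintype.card (Equiv.Perm W) * δ + 2 * (Fintype.card (Equiv.Perm W) * (#E * ε)) ^ 2 := by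
  obtain ⟨a⟩ := ‹Nonempty W›
  set R := Fintype.card W - 1 with hR
  set N : ℝ := (Fintype.card (Equiv.Perm W) : ℝ) with hN
  have hg0' : ∀ x, 0 < g x := fun x => by linarith [hg0 x]
  set μ := 𝔼 y, g y with hμ
  have hμ0 : 1 / 2 ≤ μ := le_expect univ_nonempty fun x _ => hg0 x
  have hμ1 : μ ≤ 1 := expect_le univ_nonempty fun x _ => hg1 x
  have hμpos : 0 < μ := by linarith
  choose Z hZ hZ1 hZ2 using fun σ : Equiv.Perm W =>
    exists_expect_weightedHom_eq hA0 hA1 hp0 hp1 hε (not_isDiag_of_mem_image_perm (σ := σ) hE) a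
      hg0' hg1
  simp only [card_image_perm] at hZ2
  let G : V → ℝ := fun x => ∑ σ, (Z σ x - p ^ #E * μ ^ R)
  have hpm : p ^ #E ≤ 1 := pow_le_one₀ hp0.le hp1
  have hpm0 : 0 < p ^ #E := pow_pos hp0 _
  have hμR : μ ^ R ≤ 1 := pow_le_one₀ hμpos.le hμ1
  have hμR0 : 0 < μ ^ R := pow_pos hμpos _
  have hG : ∀ x, |G x| ≤ 2 * N := by
    intro x
    refine (abs_sum_le_sum_abs _ _).trans ?_
    refine (sum_le_card_nsmul univ _ 2 fun σ _ => ?_).trans ?_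
    · have h1 := abs_le.1 (hZ1 σ x)
      have h2 : p ^ #E * μ ^ R ≤ 1 := mul_le_one₀ hpm hμR0.le hμR
      have h3 : 0 < p ^ #E * μ ^ R := mul_pos hpm0 hμR0
      rw [abs_le]
      constructor <;> linarith
    · rw [card_univ, nsmul_eq_mul, mul_comm]
  have hmean : 𝔼 x, |G x| ≤ δ := by
    let h : V → ℝ := fun x => if 0 ≤ G x then 1 else -1
    have hh : ∀ x, |h x| ≤ 1 := fun x => by dsimp only [h]; split_ifs <;> simp
    have h1 := hA (update (fun _ => g) a h) (by
      intro w x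
      by_cases hw : w = a
      · subst hw
        rw [update_self]
        exact hh x
      · rw [update_of_ne hw, abs_of_pos (hg0' x)]
        exact hg1 x)
    refine le_trans (le_of_eq ?_) ((le_abs_self _).trans h1)
    have h2 : ∏ w, 𝔼 x, update (fun _ => g) a h w x = (𝔼 x, h x) * μ ^ R := by
      rw [← mul_prod_erase univ _ (mem_univ a), update_self]
      congr 1
      rw [prod_congr rfl (g := fun _ => μ), prod_const, card_erase_of_mem (mem_univ a), card_univ]
      intro w hw
      rw [update_of_ne (by simpa using hw)]
    simp_rw [hZ, h2]
    have h3 : ∀ σ : Equiv.Perm W, 𝔼 x, h x * Z σ x - p ^ #E * ((𝔼 x, h x) * μ ^ R) =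
        𝔼 x, h x * (Z σ x - p ^ #E * μ ^ R) := by
      intro σ
      simp_rw [mul_sub, expect_sub_distrib, ← expect_mul]
      ring
    simp_rw [h3]
    rw [← expect_sum_comm]
    refine expect_congr rfl fun x _ => ?_
    rw [← mul_sum]
    change |G x| = h x * G x
    dsimp only [h]
    split_ifs with hx
    · rw [abs_of_nonneg hx, one_mul]
    · rw [abs_of_neg (not_le.1 hx), neg_one_mul]
  have hN0 : 0 ≤ N := Nat.cast_nonneg _
  have hpt : ∀ x, p ^ #E * (1 / 2) ^ R * |𝔼 y, (A s(x, y) - p) * g y| ≤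
      |G x| + N * (#E * ε) := by
    intro x
    set D := 𝔼 y, A s(x, y) * g y with hD
    have hD0 : 0 ≤ D := expect_nonneg fun y _ => mul_nonneg (hA0 _) (hg0' _).le
    have h1 : 𝔼 y, (A s(x, y) - p) * g y = D - p * μ := by
      simp_rw [sub_mul, expect_sub_distrib, ← mul_expect]
      rfl
    have hpμ : 0 < p * μ := mul_pos hp0 hμpos
    have h2 : |D - p * μ| ≤ |D / (p * μ) - 1| := by
      have : D - p * μ = (p * μ) * (D / (p * μ) - 1) := by field_simp
      rw [this, abs_mul, abs_of_pos hpμ]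
      exact mul_le_of_le_one_left (abs_nonneg _) (mul_le_one₀ hp1 hμpos.le hμ1)
    have h3 : |D / (p * μ) - 1| ≤ |∑ σ : Equiv.Perm W,
        ((D / (p * μ)) ^ #{w | s(a, w) ∈ E.image (Sym2.map σ)} - 1)| := by
      refine abs_sub_one_le_abs_sum_pow_sub_one univ _ (div_nonneg hD0 hpμ.le) ?_
      obtain ⟨e, he⟩ := hne
      induction e using Sym2.ind with | _ i j =>
      refine ⟨Equiv.swap i a, mem_univ _, ?_⟩
      rw [← Nat.pos_iff_ne_zero, card_pos]
      refine ⟨Equiv.swap i a j, ?_⟩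
      simp only [mem_filter, mem_univ, true_and]
      exact mem_image.2 ⟨_, he, by simp⟩
    have h4 : p ^ #E * μ ^ R * ∑ σ : Equiv.Perm W,
        ((D / (p * μ)) ^ #{w | s(a, w) ∈ E.image (Sym2.map σ)} - 1) =
        G x - ∑ σ, (Z σ x - p ^ #E * μ ^ R *
          (D / (p * μ)) ^ #{w | s(a, w) ∈ E.image (Sym2.map σ)}) := by
      dsimp only [G]
      rw [mul_sum, ← sum_sub_distrib]
      refine sum_congr rfl fun σ _ => ?_
      ring
    rw [h1]
    calc p ^ #E * (1 / 2) ^ R * |D - p * μ|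
        ≤ p ^ #E * μ ^ R * |∑ σ : Equiv.Perm W,
          ((D / (p * μ)) ^ #{w | s(a, w) ∈ E.image (Sym2.map σ)} - 1)| := by
          refine mul_le_mul ?_ (h2.trans h3) (abs_nonneg _) (mul_pos hpm0 hμR0).le
          exact mul_le_mul_of_nonneg_left (pow_le_pow_left₀ (by norm_num) hμ0 _) hpm0.le
      _ = |G x - ∑ σ, (Z σ x - p ^ #E * μ ^ R *
          (D / (p * μ)) ^ #{w | s(a, w) ∈ E.image (Sym2.map σ)})| := by
          rw [← h4, abs_mul, abs_of_pos (mul_pos hpm0 hμR0)]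
      _ ≤ |G x| + N * (#E * ε) := by
          refine (abs_sub _ _).trans (add_le_add_right ?_ _)
          refine (abs_sum_le_sum_abs _ _).trans ?_
          refine (sum_le_card_nsmul univ _ _ fun σ _ => hZ2 σ x).trans ?_
          rw [card_univ, nsmul_eq_mul]
  calc (p ^ #E * (1 / 2) ^ R) ^ 2 * 𝔼 x, (𝔼 y, (A s(x, y) - p) * g y) ^ 2
      = 𝔼 x, (p ^ #E * (1 / 2) ^ R * |𝔼 y, (A s(x, y) - p) * g y|) ^ 2 := by
        simp_rw [mul_pow _ |_|, sq_abs]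
        rw [mul_expect]
    _ ≤ 𝔼 x, (4 * N * |G x| + 2 * (N * (#E * ε)) ^ 2) := by
        refine expect_le_expect fun x _ => ?_
        have h0 : 0 ≤ p ^ #E * (1 / 2) ^ R * |𝔼 y, (A s(x, y) - p) * g y| := by positivity
        have h1 := pow_le_pow_left₀ h0 (hpt x) 2
        have h2 : |G x| * |G x| ≤ 2 * N * |G x| := mul_le_mul_of_nonneg_right (hG x) (abs_nonneg _)
        nlinarith [sq_nonneg (|G x| - N * (#E * ε))]
    _ ≤ 4 * N * δ + 2 * (N * (#E * ε)) ^ 2 := by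
        rw [expect_add_distrib, ← mul_expect, expect_const univ_nonempty]
        have := mul_le_mul_of_nonneg_left hmean (by positivity : 0 ≤ 4 * N)
        linarith

/-- If `A` has the count property with error `δ` and cut distance at most `ε` to `p`, then weighted
degrees are regular in mean square, with an error that is quadratic in `ε`: the position of one
vertex can be tested exactly, and the density of copies through `x` is monotone in the degree. -/
theorem exists_expect_sq_le [Nonempty W] {E : Finset (Sym2 W)}
    (hE : ∀ e ∈ E, ¬ e.IsDiag) (hne : E.Nonempty) {p : ℝ} (hp0 : 0 < p) (hp1 : p ≤ 1) :
    ∃ C : ℝ, 0 < C ∧ ∀ (V : Type u) [Fintype V] [Nonempty V] (A : Sym2 V → ℝ),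
      (∀ e, 0 ≤ A e) → (∀ e, A e ≤ 1) → ∀ δ ε : ℝ, SymmetricCount E p δ A →
      (∀ f g : V → ℝ, (∀ x, |f x| ≤ 1) → (∀ x, |g x| ≤ 1) →
        |pairing (fun e => A e - p) f g| ≤ ε) →
      ∀ f : V → ℝ, (∀ x, |f x| ≤ 1) →
        𝔼 x, (𝔼 y, (A s(x, y) - p) * f y) ^ 2 ≤ C * (δ + ε ^ 2) := by
  set N : ℝ := (Fintype.card (Equiv.Perm W) : ℝ) with hN
  have hN0 : 0 < N := Nat.cast_pos.2 Fintype.card_pos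
  set B : ℝ := (p ^ #E * (1 / 2) ^ (Fintype.card W - 1)) ^ 2 with hB
  have hB0 : 0 < B := by positivity
  refine ⟨50 * ((4 * N + 2 * (N * #E) ^ 2) / B), by positivity, ?_⟩
  intro V _ _ A hA0 hA1 δ ε hA hε f hf
  have hδ : 0 ≤ δ := (abs_nonneg _).trans (hA 0 (by simp))
  have key : ∀ g : V → ℝ, (∀ x, 1 / 2 ≤ g x) → (∀ x, g x ≤ 1) →
      𝔼 x, (𝔼 y, (A s(x, y) - p) * g y) ^ 2 ≤ (4 * N + 2 * (N * #E) ^ 2) / B * (δ + ε ^ 2) := by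
    intro g hg0 hg1
    have h := expect_sq_le_of_half_le hE hne hp0 hp1 hA0 hA1 hA hε hg0 hg1
    rw [div_mul_eq_mul_div, le_div_iff₀ hB0, mul_comm]
    refine h.trans ?_
    have h1 : 0 ≤ (N * #E) ^ 2 * δ := by positivity
    have h2 : 0 ≤ N * ε ^ 2 := by positivity
    nlinarith
  have h1 := key (fun _ => 1) (by intro; norm_num) (by intro; norm_num)
  have h2 := key (fun x => (3 + f x) / 4) (fun x => by linarith [(abs_le.1 (hf x)).1])
    (fun x => by linarith [(abs_le.1 (hf x)).2])
  calc 𝔼 x, (𝔼 y, (A s(x, y) - p) * f y) ^ 2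
      = 𝔼 x, (4 * (𝔼 y, (A s(x, y) - p) * ((3 + f y) / 4)) -
          3 * 𝔼 y, (A s(x, y) - p) * 1) ^ 2 := by
        refine expect_congr rfl fun x _ => ?_
        congr 1
        rw [mul_expect, mul_expect, ← expect_sub_distrib]
        refine expect_congr rfl fun y _ => ?_
        ring
    _ ≤ 𝔼 x, (32 * (𝔼 y, (A s(x, y) - p) * ((3 + f y) / 4)) ^ 2 +
          18 * (𝔼 y, (A s(x, y) - p) * 1) ^ 2) := by
        refine expect_le_expect fun x _ => ?_
        nlinarith [sq_nonneg (4 * (𝔼 y, (A s(x, y) - p) * ((3 + f y) / 4)) +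
          3 * 𝔼 y, (A s(x, y) - p) * 1)]
    _ ≤ _ := by
        rw [expect_add_distrib, ← mul_expect, ← mul_expect]
        linarith

/-! ### Expansion around the constant kernel -/

/-- The coefficient with which the density of `F` in `A - p` occurs when the densities in `A` of all
relabellings of `E` are expanded around the constant `p`. -/
noncomputable def relabelCoeff (E : Finset (Sym2 W)) (p : ℝ) (F : Finset (Sym2 W)) : ℝ :=
  ∑ σ : Equiv.Perm W, if F ⊆ E.image (Sym2.map σ) then p ^ (#E - #F) else 0

section Coeff

variable {E F F' : Finset (Sym2 W)} {p : ℝ}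

lemma relabelCoeff_nonneg (hp : 0 ≤ p) : 0 ≤ relabelCoeff E p F :=
  sum_nonneg fun σ _ => by split_ifs <;> positivity

lemma pow_card_le_relabelCoeff (hp0 : 0 ≤ p) (hp1 : p ≤ 1) {σ : Equiv.Perm W}
    (h : F ⊆ E.image (Sym2.map σ)) : p ^ #E ≤ relabelCoeff E p F := by
  refine le_trans ?_ (single_le_sum (fun σ _ => ?_) (mem_univ σ))
  · rw [if_pos h]
    exact pow_le_pow_of_le_one hp0 hp1 (Nat.sub_le _ _)
  · split_ifs <;> positivity

lemma exists_subset_of_relabelCoeff_ne_zero (h : relabelCoeff E p F ≠ 0) :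
    ∃ σ : Equiv.Perm W, F ⊆ E.image (Sym2.map σ) := by
  by_contra! h'
  exact h (sum_eq_zero fun σ _ => if_neg (h' σ))

lemma expect_weightedHom_eq_sum (A : Sym2 V → ℝ) (u : W → V → ℝ) (E : Finset (Sym2 W)) (p : ℝ) :
    𝔼 φ, weightedHom A u E φ =
      ∑ F ∈ E.powerset, p ^ (#E - #F) * 𝔼 φ, weightedHom (fun e => A e - p) u F φ := by
  simp_rw [mul_expect]
  rw [← expect_sum_comm]
  refine expect_congr rfl fun φ _ => ?_
  have h := prod_add (fun e : Sym2 W => A (e.map φ) - p) (fun _ => p) E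
  simp only [sub_add_cancel] at h
  rw [weightedHom, h, mul_sum]
  refine sum_congr rfl fun F hF => ?_
  rw [prod_const, card_sdiff_of_subset (mem_powerset.1 hF), weightedHom]
  ring

lemma SymmetricCount.abs_sum_relabelCoeff_le {A : Sym2 V → ℝ} {δ : ℝ}
    (hA : SymmetricCount E p δ A) {u : W → V → ℝ} (hu : ∀ w x, |u w x| ≤ 1) :
    |∑ F : Finset (Sym2 W) with F.Nonempty,
      relabelCoeff E p F * 𝔼 φ, weightedHom (fun e => A e - p) u F φ| ≤ δ := by
  refine le_trans (le_of_eq ?_) (hA u hu)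
  congr 1
  simp_rw [relabelCoeff, sum_mul]
  rw [sum_comm]
  refine sum_congr rfl fun σ _ => ?_
  rw [expect_weightedHom_eq_sum A u _ p, card_image_perm,
    ← add_sum_erase _ _ (empty_mem_powerset _), card_empty, Nat.sub_zero]
  have h0 : 𝔼 φ, weightedHom (fun e => A e - p) u ∅ φ = ∏ w, 𝔼 x, u w x := by
    simp [weightedHom, expect_prod]
  rw [h0, add_sub_cancel_left]
  simp_rw [ite_mul, zero_mul]
  rw [← sum_filter]
  refine sum_congr ?_ fun _ _ => rfl
  ext F
  simp [nonempty_iff_ne_empty]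

end Coeff

/-! ### Elimination of cliques -/

/-- The edges of the complete graph on the vertex set `I`. -/
def cliqueEdges (I : Finset W) : Finset (Sym2 W) := I.sym2.filter fun e => ¬ e.IsDiag

lemma mk_mem_cliqueEdges {I : Finset W} {i j : W} :
    s(i, j) ∈ cliqueEdges I ↔ i ∈ I ∧ j ∈ I ∧ i ≠ j := by
  simp [cliqueEdges, and_assoc]

lemma cliqueEdges_insert {I : Finset W} {j : W} (hj : j ∉ I) :
    cliqueEdges (insert j I) = cliqueEdges I ∪ I.image fun w => s(j, w) := by
  ext e
  induction e using Sym2.ind with | _ a b =>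
  simp only [mem_union, mk_mem_cliqueEdges, mem_insert, mem_image, Sym2.eq_iff]
  constructor
  · rintro ⟨rfl | ha, rfl | hb, hab⟩
    · exact absurd rfl hab
    · exact Or.inr ⟨b, hb, Or.inl ⟨rfl, rfl⟩⟩
    · exact Or.inr ⟨a, ha, Or.inr ⟨rfl, rfl⟩⟩
    · exact Or.inl ⟨ha, hb, hab⟩
  · rintro (⟨ha, hb, hab⟩ | ⟨w, hw, ⟨rfl, rfl⟩ | ⟨rfl, rfl⟩⟩)
    · exact ⟨Or.inr ha, Or.inr hb, hab⟩
    · exact ⟨Or.inl rfl, Or.inr hw, fun h => hj (h ▸ hw)⟩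
    · exact ⟨Or.inr hw, Or.inl rfl, fun h => hj (h ▸ hw)⟩

/-- The vertex weights obtained from `u` by adding to the vertices of `I` the factor `T(y, ·)` and
removing the weight at `j`. -/
noncomputable def coneWeight (T : Sym2 V → ℝ) (u : W → V → ℝ) (I : Finset W) (j : W) (y : V)
    (w : W) (x : V) : ℝ :=
  (if w = j then 1 else u w x) * (if w ∈ I then T s(y, x) else 1)

lemma prod_coneWeight (T : Sym2 V → ℝ) (u : W → V → ℝ) (I : Finset W) (j : W) (y : V)
    (φ : W → V) :
    ∏ w, coneWeight T u I j y w (φ w) =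
      (∏ w ∈ univ.erase j, u w (φ w)) * ∏ w ∈ I, T s(y, φ w) := by
  simp_rw [coneWeight]
  rw [prod_mul_distrib, prod_ite_mem, univ_inter, ← mul_prod_erase univ _ (mem_univ j), if_pos rfl,
    one_mul]
  congr 1
  refine prod_congr rfl fun w hw => ?_
  rw [if_neg (by simpa using hw)]

lemma expect_coneWeight_cliqueEdges (T : Sym2 V → ℝ) (u : W → V → ℝ) {I : Finset W} {j : W}
    (hj : j ∉ I) :
    𝔼 y, u j y * 𝔼 φ, weightedHom T (coneWeight T u I j y) (cliqueEdges I) φ =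
      𝔼 φ, weightedHom T u (cliqueEdges (insert j I)) φ := by
  rw [expect_update j, expect_comm]
  refine expect_congr rfl fun y _ => ?_
  rw [mul_expect]
  refine expect_congr rfl fun φ _ => ?_
  have hdisj : Disjoint (cliqueEdges I) (I.image fun w => s(j, w)) := by
    rw [disjoint_right]
    intro e he he'
    obtain ⟨w, _, rfl⟩ := mem_image.1 he
    exact hj (mk_mem_cliqueEdges.1 he').1
  have h1 : ∏ w, u w (update φ j y w) = u j y * ∏ w ∈ univ.erase j, u w (φ w) := by
    rw [← mul_prod_erase univ _ (mem_univ j), update_self]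
    congr 1
    refine prod_congr rfl fun w hw => ?_
    rw [update_of_ne (by simpa using hw)]
  rw [weightedHom, weightedHom, prod_coneWeight, h1, cliqueEdges_insert hj, prod_union hdisj,
    prod_image fun w _ w' _ h => Sym2.congr_right.1 h]
  have h2 : ∏ e ∈ cliqueEdges I, T (e.map (update φ j y)) =
      ∏ e ∈ cliqueEdges I, T (e.map φ) := by
    refine prod_congr rfl fun e he => ?_
    rw [sym2_map_update]
    intro hje
    obtain ⟨w, rfl⟩ := Sym2.mem_iff_exists.1 hje
    exact hj (mk_mem_cliqueEdges.1 he).1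
  have h3 : ∏ w ∈ I, T (s(j, w).map (update φ j y)) = ∏ w ∈ I, T s(y, φ w) := by
    refine prod_congr rfl fun w hw => ?_
    rw [Sym2.map_mk, update_self, update_of_ne fun h : w = j => hj (h ▸ hw)]
  rw [h2, h3]
  ring

/-- After a new vertex is joined to `I`, every graph other than the clique on `I` has two
non-adjacent non-isolated vertices. -/
lemma abs_expect_coneWeight_le [Nonempty V] {T : Sym2 V → ℝ} (hT : ∀ e, |T e| ≤ 1)
    {κ : ℝ} (hκ : ∀ f : V → ℝ, (∀ x, |f x| ≤ 1) → 𝔼 x, (𝔼 y, T s(x, y) * f y) ^ 2 ≤ κ)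
    {u : W → V → ℝ} (hu : ∀ w x, |u w x| ≤ 1) {I : Finset W} (hI : I.Nonempty) (j : W)
    {F : Finset (Sym2 W)} (hF : ∀ e ∈ F, ¬ e.IsDiag) (hFI : F ≠ cliqueEdges I) :
    |𝔼 y, u j y * 𝔼 φ, weightedHom T (coneWeight T u I j y) F φ| ≤ κ := by
  let u' : Option W → V → ℝ := fun o x => o.elim (u j x) fun w => if w = j then 1 else u w x
  let F' : Finset (Sym2 (Option W)) :=
    F.image (Sym2.map some) ∪ I.image fun w => s(none, some w)
  have hu' : ∀ o x, |u' o x| ≤ 1 := by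
    rintro (_ | w) x
    · exact hu _ _
    · dsimp only [u', Option.elim]
      split_ifs
      · simp
      · exact hu _ _
  have hsome : ∀ a b : W, s(some a, some b) ∈ F' ↔ s(a, b) ∈ F := by
    intro a b
    have hinj := Sym2.map.injective (Option.some_injective W)
    have h0 : s(some a, some b) = Sym2.map some s(a, b) := rfl
    rw [mem_union, h0, hinj.mem_finset_image]
    simp
  have hnone : ∀ a : W, s(none, some a) ∈ F' ↔ a ∈ I := by
    intro a
    simp only [F', mem_union, mem_image]
    constructor
    · rintro (⟨e, _, he⟩ | ⟨w, hw, he⟩)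
      · induction e using Sym2.ind with | _ b c => simp at he
      · simp at he
        exact he ▸ hw
    · exact fun h => Or.inr ⟨a, h, rfl⟩
  have hEq : 𝔼 y, u j y * 𝔼 φ, weightedHom T (coneWeight T u I j y) F φ =
      𝔼 ψ : Option W → V, weightedHom T u' F' ψ := by
    simp_rw [mul_expect]
    rw [← expect_product', univ_product_univ]
    refine Fintype.expect_equiv (Equiv.piOptionEquivProd (β := fun _ : Option W => V)).symm _ _ ?_
    rintro ⟨y, φ⟩
    have hdisj : Disjoint (F.image (Sym2.map some)) (I.image fun w => s(none, some w)) := by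
      rw [disjoint_right]
      intro e he he'
      obtain ⟨w, _, rfl⟩ := mem_image.1 he
      obtain ⟨e, _, h⟩ := mem_image.1 he'
      induction e using Sym2.ind with | _ b c => simp at h
    rw [weightedHom, weightedHom, prod_coneWeight, Fintype.prod_option, prod_union hdisj,
      prod_image fun e _ e' _ h => Sym2.map.injective (Option.some_injective W) h,
      prod_image fun w _ w' _ h => by simpa using h]
    have h1 : ∏ w : W, u' (some w) ((Equiv.piOptionEquivProd (β := fun _ : Option W => V)).symm
        (y, φ) (some w)) = ∏ w ∈ univ.erase j, u w (φ w) := by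
      rw [← mul_prod_erase univ _ (mem_univ j)]
      simp only [u', Option.elim, if_true, one_mul]
      refine prod_congr rfl fun w hw => ?_
      rw [if_neg (by simpa using hw)]
      rfl
    have h2 : ∏ e ∈ F, T ((e.map some).map
        ((Equiv.piOptionEquivProd (β := fun _ : Option W => V)).symm (y, φ))) =
        ∏ e ∈ F, T (e.map φ) := by
      refine prod_congr rfl fun e _ => ?_
      rw [Sym2.map_map]
      rfl
    rw [h1, h2]
    simp only [Sym2.map_mk]
    change _ = u j y * _ * (_ * ∏ w ∈ I, T s(y, φ w))
    ring
  rw [hEq]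
  obtain ⟨w₀, hw₀⟩ := hI
  by_cases h : F ⊆ cliqueEdges I
  · obtain ⟨e, he, heF⟩ := exists_of_ssubset (h.ssubset_of_ne hFI)
    induction e using Sym2.ind with | _ a b =>
    obtain ⟨ha, hb, hab⟩ := mk_mem_cliqueEdges.1 he
    refine abs_expect_weightedHom_le_of_not_adj hT hκ hu' (i := some a) (j := some b) (i' := none)
      (j' := none) (by simpa using hab) (by rwa [hsome]) (by simp) ?_ (by simp) ?_
    · rwa [Sym2.eq_swap, hnone]
    · rwa [Sym2.eq_swap, hnone]
  · obtain ⟨a, b, hab, ha⟩ : ∃ a b, s(a, b) ∈ F ∧ a ∉ I := by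
      obtain ⟨e, heF, he⟩ := not_subset.1 h
      induction e using Sym2.ind with | _ a b =>
      by_cases ha : a ∈ I
      · refine ⟨b, a, by rwa [Sym2.eq_swap], fun hb => he (mk_mem_cliqueEdges.2 ⟨ha, hb, ?_⟩)⟩
        simpa using hF _ heF
      · exact ⟨a, b, heF, ha⟩
    refine abs_expect_weightedHom_le_of_not_adj hT hκ hu' (i := none) (j := some a) (i' := some w₀)
      (j' := some b) (by simp) (by rwa [hnone]) (by simp) (by rwa [hnone]) ?_ (by rwa [hsome])
    simpa using hF _ hab

/-- Testing the count property against the weights `T(y, ·)` on the vertices of `I` and averaging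
over `y` isolates the density in `T` of the clique on one more vertex. -/
lemma SymmetricCount.abs_expect_cliqueEdges_le [Nonempty V] {E : Finset (Sym2 W)}
    (hE : ∀ e ∈ E, ¬ e.IsDiag) {p : ℝ} (hp0 : 0 ≤ p) {A : Sym2 V → ℝ} {δ : ℝ}
    (hA : SymmetricCount E p δ A) (hT : ∀ e, |A e - p| ≤ 1) {κ : ℝ}
    (hκ : ∀ f : V → ℝ, (∀ x, |f x| ≤ 1) → 𝔼 x, (𝔼 y, (A s(x, y) - p) * f y) ^ 2 ≤ κ)
    {u : W → V → ℝ} (hu : ∀ w x, |u w x| ≤ 1) {I : Finset W} (hI : 1 < #I) {j : W} (hj : j ∉ I) :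
    relabelCoeff E p (cliqueEdges I) *
        |𝔼 φ, weightedHom (fun e => A e - p) u (cliqueEdges (insert j I)) φ| ≤
      δ + (∑ F, relabelCoeff E p F) * κ := by
  set T : Sym2 V → ℝ := fun e => A e - p with hTdef
  have hκ0 : 0 ≤ κ := (expect_nonneg fun x _ => sq_nonneg _).trans (hκ 0 (by simp))
  let Q : Finset (Sym2 W) → ℝ := fun F =>
    𝔼 y, u j y * 𝔼 φ, weightedHom T (coneWeight T u I j y) F φ
  have hsum : |∑ F : Finset (Sym2 W) with F.Nonempty, relabelCoeff E p F * Q F| ≤ δ := by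
    have h1 : ∑ F : Finset (Sym2 W) with F.Nonempty, relabelCoeff E p F * Q F =
        𝔼 y, u j y * ∑ F : Finset (Sym2 W) with F.Nonempty,
          relabelCoeff E p F * 𝔼 φ, weightedHom T (coneWeight T u I j y) F φ := by
      simp_rw [Q, mul_expect _ _ (relabelCoeff E p _), mul_sum]
      rw [← expect_sum_comm]
      refine expect_congr rfl fun y _ => sum_congr rfl fun F _ => ?_
      rw [← mul_expect]
      ring
    rw [h1]
    refine (abs_expect_le _ _).trans (expect_le univ_nonempty fun y _ => ?_)
    rw [abs_mul]
    refine (mul_le_of_le_one_left (abs_nonneg _) (hu j y)).trans ?_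
    refine hA.abs_sum_relabelCoeff_le fun w x => abs_mul_le_one ?_ ?_
    · split_ifs
      · simp
      · exact hu _ _
    · split_ifs
      · exact hT _
      · simp
  have hmem : cliqueEdges I ∈ (univ.filter Finset.Nonempty : Finset (Finset (Sym2 W))) := by
    obtain ⟨a, ha, b, hb, hab⟩ := one_lt_card.1 hI
    simp only [mem_filter, mem_univ, true_and]
    exact ⟨_, mk_mem_cliqueEdges.2 ⟨ha, hb, hab⟩⟩
  rw [← add_sum_erase _ _ hmem] at hsum
  have hrest : |∑ F ∈ (univ.filter Finset.Nonempty).erase (cliqueEdges I),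
      relabelCoeff E p F * Q F| ≤ (∑ F, relabelCoeff E p F) * κ := by
    rw [sum_mul]
    refine (abs_sum_le_sum_abs _ _).trans ((sum_le_sum fun F hF => ?_).trans
      (sum_le_sum_of_subset_of_nonneg (subset_univ _) fun F _ _ =>
        mul_nonneg (relabelCoeff_nonneg hp0) hκ0))
    rw [abs_mul, abs_of_nonneg (relabelCoeff_nonneg hp0)]
    rcases eq_or_ne (relabelCoeff E p F) 0 with h0 | h0
    · simp [h0]
    · obtain ⟨σ, hσ⟩ := exists_subset_of_relabelCoeff_ne_zero h0
      exact mul_le_mul_of_nonneg_left (abs_expect_coneWeight_le hT hκ hu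
        (card_pos.1 (by omega)) j (fun e he => not_isDiag_of_mem_image_perm hE e (hσ he))
        (mem_erase.1 hF).1) (relabelCoeff_nonneg hp0)
  have hQ : Q (cliqueEdges I) = 𝔼 φ, weightedHom T u (cliqueEdges (insert j I)) φ :=
    expect_coneWeight_cliqueEdges T u hj
  rw [hQ] at hsum
  rw [← abs_of_nonneg (relabelCoeff_nonneg hp0 : 0 ≤ relabelCoeff E p (cliqueEdges I)), ← abs_mul]
  have := abs_sub_abs_le_abs_sub (relabelCoeff E p (cliqueEdges I) *
    𝔼 φ, weightedHom T u (cliqueEdges (insert j I)) φ) (-∑ F ∈ (univ.filter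
      Finset.Nonempty).erase (cliqueEdges I), relabelCoeff E p F * Q F)
  rw [abs_neg, sub_neg_eq_add] at this
  linarith

/-! ### Bootstrapping -/

/-- A graph with at least two edges either has two non-adjacent non-isolated vertices or is a clique
on at least three vertices. -/
lemma exists_not_adj_or_eq_cliqueEdges {F : Finset (Sym2 W)} (hF : ∀ e ∈ F, ¬ e.IsDiag)
    (hF2 : 1 < #F) :
    (∃ i j i' j', i ≠ j ∧ s(i, j) ∉ F ∧ i ≠ i' ∧ s(i, i') ∈ F ∧ j ≠ j' ∧ s(j, j') ∈ F) ∨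
      ∃ (I : Finset W) (j : W), 1 < #I ∧ j ∉ I ∧ F = cliqueEdges (insert j I) := by
  have hne : ∀ {a b : W}, s(a, b) ∈ F → a ≠ b := fun h => by simpa using hF _ h
  refine or_iff_not_imp_left.2 fun hno => ?_
  push Not at hno
  let J : Finset W := univ.filter fun i => ∃ i', s(i, i') ∈ F
  have hJ : F = cliqueEdges J := by
    ext e
    induction e using Sym2.ind with | _ a b =>
    rw [mk_mem_cliqueEdges]
    simp only [J, mem_filter, mem_univ, true_and]
    constructor
    · exact fun h => ⟨⟨b, h⟩, ⟨a, by rwa [Sym2.eq_swap]⟩, hne h⟩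
    · rintro ⟨⟨a', ha⟩, ⟨b', hb⟩, hab⟩
      by_contra h
      exact hno a b a' b' hab h (hne ha) ha (hne hb) hb
  obtain ⟨e, he, e', he', hee⟩ := one_lt_card.1 hF2
  obtain ⟨c, hc, hce⟩ : ∃ c, c ∈ e' ∧ c ∉ e := by
    by_contra! h
    induction e' using Sym2.ind with | _ a b =>
    exact hee ((Sym2.mem_and_mem_iff (hne he')).1 ⟨h a (by simp), h b (by simp)⟩)
  induction e using Sym2.ind with | _ a b =>
  obtain ⟨d, rfl⟩ := Sym2.mem_iff_exists.1 hc
  rw [hJ, mk_mem_cliqueEdges] at he he'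
  have hca : a ≠ c := fun h => hce (by simp [h])
  have hcb : b ≠ c := fun h => hce (by simp [h])
  refine ⟨J.erase c, c, ?_, notMem_erase _ _, by rw [insert_erase he'.1, ← hJ]⟩
  exact one_lt_card.2 ⟨a, mem_erase.2 ⟨hca, he.1⟩, b, mem_erase.2 ⟨hcb, he.2.1⟩, he.2.2⟩

lemma cliqueEdges_mono {I J : Finset W} (h : I ⊆ J) : cliqueEdges I ⊆ cliqueEdges J :=
  filter_subset_filter _ (sym2_mono h)

lemma expect_weightedHom_singleton [Nonempty V] (T : Sym2 V → ℝ) (u : W → V → ℝ) {i j : W}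
    (hij : i ≠ j) :
    𝔼 φ, weightedHom T u {s(i, j)} φ =
      (∏ w ∈ (univ.erase i).erase j, 𝔼 x, u w x) * pairing T (u i) (u j) := by
  have h := expect_mul_weightedHom (V := V) (K := T) (u := u) (E := ∅) hij (by simp)
    (fun x y => T s(x, y))
  simp only [restFactor, starFactor, filter_empty, prod_empty, mul_one, update_self] at h
  rw [← expect_mul, expect_prod_subset] at h
  rw [pairing, ← h]
  refine expect_congr rfl fun φ _ => ?_
  simp [weightedHom, mul_comm]

lemma mul_abs_le_of_abs_sum_le {ι : Type*} [Fintype ι] [DecidableEq ι] {c t : ι → ℝ}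
    (hc : ∀ e, 0 ≤ c e) (X : Finset ι) {e₀ : ι} (he₀ : e₀ ∈ X) {π t₀ b L : ℝ} (hπ : π ≤ c e₀)
    (hb : 0 ≤ b) (hX : ∀ e ∈ X, c e ≠ 0 → t e = t₀) (hX' : ∀ e ∉ X, c e ≠ 0 → |t e| ≤ b)
    (hL : |∑ e, c e * t e| ≤ L) : π * |t₀| ≤ L + (∑ e, c e) * b := by
  have h1 : ∑ e ∈ X, c e * t e = (∑ e ∈ X, c e) * t₀ := by
    rw [sum_mul]
    refine sum_congr rfl fun e he => ?_
    rcases eq_or_ne (c e) 0 with h | h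
    · simp [h]
    · rw [hX e he h]
  have h2 : |∑ e ∈ Xᶜ, c e * t e| ≤ (∑ e, c e) * b := by
    rw [sum_mul]
    refine (abs_sum_le_sum_abs _ _).trans ((sum_le_sum fun e he => ?_).trans
      (sum_le_sum_of_subset_of_nonneg (subset_univ _) fun e _ _ => mul_nonneg (hc e) hb))
    rw [abs_mul, abs_of_nonneg (hc e)]
    rcases eq_or_ne (c e) 0 with h | h
    · simp [h]
    · exact mul_le_mul_of_nonneg_left (hX' e (mem_compl.1 he) h) (hc e)
  rw [← sum_add_sum_compl X, h1] at hL
  have h3 := abs_sub_abs_le_abs_sub ((∑ e ∈ X, c e) * t₀) (-∑ e ∈ Xᶜ, c e * t e)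
  rw [abs_neg, sub_neg_eq_add, abs_mul, abs_of_nonneg (sum_nonneg fun e _ => hc e)] at h3
  have h4 : π * |t₀| ≤ (∑ e ∈ X, c e) * |t₀| :=
    mul_le_mul_of_nonneg_right (hπ.trans (single_le_sum (fun e _ => hc e) he₀)) (abs_nonneg _)
  linarith

/-- If a positive linear combination of the single-edge densities of `T` is small for all bounded
weights, then so are all values of the bilinear form of `T`. -/
lemma abs_pairing_le_of_abs_sum_singleton_le [Nonempty V] {T : Sym2 V → ℝ} {c : Sym2 W → ℝ}
    (hc0 : ∀ e, 0 ≤ c e) (hdiag : ∀ e, c e ≠ 0 → ¬ e.IsDiag) {π : ℝ} (hπ0 : 0 < π) {a b : W}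
    (hab : a ≠ b) (hcab : π ≤ c s(a, b)) {L : ℝ} (hL0 : 0 ≤ L)
    (hlin : ∀ u : W → V → ℝ, (∀ w x, |u w x| ≤ 1) →
      |∑ e, c e * 𝔼 φ, weightedHom T u {e} φ| ≤ L)
    {f g : V → ℝ} (hf : ∀ x, |f x| ≤ 1) (hg : ∀ x, |g x| ≤ 1) :
    |pairing T f g| ≤
      (L + (∑ e, c e) * (L / π + (L + (∑ e, c e) * (L / π)) / π)) / π := by
  set S' : ℝ := ∑ e, c e with hS'
  have hS'0 : 0 ≤ S' := sum_nonneg fun e _ => hc0 _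
  set b₁ : ℝ := L / π with hb₁
  set b₂ : ℝ := (L + S' * b₁) / π with hb₂
  have hb₁0 : 0 ≤ b₁ := by positivity
  have hb₂0 : 0 ≤ b₂ := by positivity
  have hone : |(1 : ℝ)| ≤ 1 := by simp
  -- testing against `1` everywhere controls the total mass of `T`
  have hprod1 : ∀ (s : Finset W) (u : W → V → ℝ), (∀ w ∈ s, u w = fun _ => 1) →
      ∏ w ∈ s, 𝔼 x, u w x = 1 := fun s u h => prod_eq_one fun w hw => by
    rw [h w hw, expect_const univ_nonempty]
  have hd₁ : |pairing T (fun _ => 1) (fun _ => 1)| ≤ b₁ := by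
    have h := mul_abs_le_of_abs_sum_le hc0 univ (mem_univ s(a, b)) hcab le_rfl
      (t₀ := pairing T (fun _ => 1) (fun _ => 1)) (fun e _ he => ?_)
      (fun e he => absurd (mem_univ e) he) (hlin (fun _ _ => 1) fun _ _ => hone)
    · rw [mul_zero, add_zero] at h
      rw [hb₁, le_div_iff₀ hπ0, mul_comm]
      exact h
    · induction e using Sym2.ind with | _ i j =>
      have hij : i ≠ j := by simpa using hdiag _ he
      rw [expect_weightedHom_singleton T _ hij, hprod1 _ _ fun _ _ => rfl, one_mul]
  -- testing against one function controls the degrees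
  have hle : ∀ (u : W → V → ℝ), (∀ w x, |u w x| ≤ 1) → ∀ {i j : W}, i ≠ j →
      |𝔼 φ, weightedHom T u {s(i, j)} φ| ≤ |pairing T (u i) (u j)| := by
    intro u hu i j hij
    rw [expect_weightedHom_singleton T _ hij, abs_mul]
    exact mul_le_of_le_one_left (abs_nonneg _)
      (abs_prod_le_one _ fun w _ => abs_expect_le_one (hu w))
  have hd₂ : ∀ f : V → ℝ, (∀ x, |f x| ≤ 1) →
      |pairing T f (fun _ => 1)| ≤ b₂ := by
    intro f hf
    have hu : ∀ w x, |update (fun _ _ => (1 : ℝ)) a f w x| ≤ 1 := by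
      intro w x
      by_cases h : w = a
      · subst h
        rw [update_self]
        exact hf x
      · rw [update_of_ne h]
        exact hone
    have h := mul_abs_le_of_abs_sum_le hc0 (univ.filter fun e => a ∈ e)
      (e₀ := s(a, b)) (by simp) hcab (b := b₁) (by positivity)
      (t₀ := pairing T f (fun _ => 1)) (fun e hae he => ?_) (fun e hae he => ?_) (hlin _ hu)
    · rw [hb₂, le_div_iff₀ hπ0, mul_comm]
      exact h
    · obtain ⟨j, rfl⟩ := Sym2.mem_iff_exists.1 (mem_filter.1 hae).2
      have hij : a ≠ j := by simpa using hdiag _ he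
      rw [expect_weightedHom_singleton T _ hij, update_self, update_of_ne hij.symm, hprod1, one_mul]
      intro w hw
      rw [update_of_ne]
      simp only [mem_erase] at hw
      exact hw.2.1
    · induction e using Sym2.ind with | _ i j =>
      have hij : i ≠ j := by simpa using hdiag _ he
      have hae' : a ∉ s(i, j) := by simpa using hae
      rw [Sym2.mem_iff, not_or] at hae'
      refine (hle _ hu hij).trans ?_
      rw [update_of_ne (Ne.symm hae'.1), update_of_ne (Ne.symm hae'.2)]
      exact hd₁
  have hu : ∀ w x, |update (update (fun _ _ => (1 : ℝ)) a f) b g w x| ≤ 1 := by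
    intro w x
    by_cases h : w = b
    · subst h
      rw [update_self]
      exact hg x
    · rw [update_of_ne h]
      by_cases h : w = a
      · subst h
        rw [update_self]
        exact hf x
      · rw [update_of_ne h]
        exact hone
  have h := mul_abs_le_of_abs_sum_le hc0 {s(a, b)} (mem_singleton_self _) hcab
    (b := (b₁ + b₂)) (by positivity) (t₀ := pairing T f g) (fun e hae he => ?_)
    (fun e hae he => ?_) (hlin _ hu)
  · rw [le_div_iff₀ hπ0, mul_comm]
    exact h
  · rw [mem_singleton] at hae
    subst hae
    rw [expect_weightedHom_singleton T _ hab, update_self, update_of_ne hab, update_self, hprod1,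
      one_mul]
    intro w hw
    simp only [mem_erase] at hw
    rw [update_of_ne hw.1, update_of_ne hw.2.1]
  · induction e using Sym2.ind with | _ i j =>
    have hij : i ≠ j := by simpa using hdiag _ he
    refine (hle _ hu hij).trans ?_
    have hval : ∀ w, update (update (fun _ _ => (1 : ℝ)) a f) b g w =
        if w = b then g else if w = a then f else fun _ => 1 := by
      intro w
      simp only [update_apply]
    rw [hval i, hval j]
    rw [mem_singleton, Sym2.eq_iff] at hae
    split_ifs with hib hjb hja hia hjb hja hjb hja
    · exact absurd (hib.trans hjb.symm) hij
    · exact absurd (Or.inr ⟨hib, hja⟩) hae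
    · linarith [hd₂ g hg]
    · exact absurd (Or.inl ⟨hia, hjb⟩) hae
    · exact absurd (hia.trans hja.symm) hij
    · linarith [hd₂ f hf]
    · rw [pairing_comm]
      linarith [hd₂ g hg]
    · rw [pairing_comm]
      linarith [hd₂ f hf]
    · linarith [hd₁]

/-- The count property makes the cut distance to `p` as small as its error `δ` and the mean square
deviation `κ` of the degrees. -/
lemma exists_abs_pairing_le_of_expect_sq_le [Nontrivial W] {E : Finset (Sym2 W)}
    (hE : ∀ e ∈ E, ¬ e.IsDiag) (hne : E.Nonempty) {p : ℝ} (hp0 : 0 < p) (hp1 : p ≤ 1) :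
    ∃ C : ℝ, 0 < C ∧ ∀ (V : Type u) [Fintype V] [Nonempty V] (A : Sym2 V → ℝ),
      (∀ e, 0 ≤ A e) → (∀ e, A e ≤ 1) → ∀ δ κ : ℝ, SymmetricCount E p δ A →
      (∀ f : V → ℝ, (∀ x, |f x| ≤ 1) → 𝔼 x, (𝔼 y, (A s(x, y) - p) * f y) ^ 2 ≤ κ) →
      ∀ f g : V → ℝ, (∀ x, |f x| ≤ 1) → (∀ x, |g x| ≤ 1) →
        |pairing (fun e => A e - p) f g| ≤ C * (δ + κ) := by
  set π : ℝ := p ^ #E with hπ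
  have hπ0 : 0 < π := pow_pos hp0 _
  set S : ℝ := ∑ F, relabelCoeff E p F with hS
  have hc0 : ∀ F, 0 ≤ relabelCoeff E p F := fun F => relabelCoeff_nonneg hp0.le
  have hS0 : 0 ≤ S := sum_nonneg fun F _ => hc0 F
  let c : Sym2 W → ℝ := fun e => relabelCoeff E p {e}
  set S' : ℝ := ∑ e, c e with hS'
  have hS'0 : 0 ≤ S' := sum_nonneg fun e _ => hc0 _
  set M : ℝ := 1 + (1 + S) / π with hM
  have hM0 : 0 < M := by positivity
  set L : ℝ := 1 + S * M with hL
  have hL0 : 0 < L := by positivity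
  refine ⟨(L + S' * (L / π + (L + S' * (L / π)) / π)) / π, by positivity, ?_⟩
  intro V _ _ A hA0 hA1 δ κ hA hκ
  have hδ : 0 ≤ δ := (abs_nonneg _).trans (hA 0 (by simp))
  have hκ0 : 0 ≤ κ := (expect_nonneg fun x _ => sq_nonneg _).trans (hκ 0 (by simp))
  have hT : ∀ e, |A e - p| ≤ 1 := fun e => by
    rw [abs_le]
    constructor <;> linarith [hA0 e, hA1 e]
  set T : Sym2 V → ℝ := fun e => A e - p with hTdef
  have hdiag : ∀ F, relabelCoeff E p F ≠ 0 → ∀ e ∈ F, ¬ e.IsDiag := fun F hF e he => by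
    obtain ⟨σ, hσ⟩ := exists_subset_of_relabelCoeff_ne_zero hF
    exact not_isDiag_of_mem_image_perm hE e (hσ he)
  -- all densities of graphs with at least two edges are negligible
  have hnonlin : ∀ u : W → V → ℝ, (∀ w x, |u w x| ≤ 1) → ∀ F, 1 < #F → relabelCoeff E p F ≠ 0 →
      |𝔼 φ, weightedHom T u F φ| ≤ M * (δ + κ) := by
    intro u hu F hF hF0
    have hbound : κ ≤ M * (δ + κ) := by
      have h1 : 0 ≤ (1 + S) / π * (δ + κ) := by positivity
      rw [hM, add_mul, one_mul]
      linarith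
    rcases exists_not_adj_or_eq_cliqueEdges (hdiag F hF0) hF with
      ⟨i, j, i', j', hij, h, hi, hi', hj, hj'⟩ | ⟨I, j, hI, hj, rfl⟩
    · exact (abs_expect_weightedHom_le_of_not_adj hT hκ hu hij h hi hi' hj hj').trans hbound
    · obtain ⟨σ, hσ⟩ := exists_subset_of_relabelCoeff_ne_zero hF0
      have h1 := hA.abs_expect_cliqueEdges_le hE hp0.le hT hκ hu hI hj
      have h2 : π ≤ relabelCoeff E p (cliqueEdges I) :=
        pow_card_le_relabelCoeff hp0.le hp1 ((cliqueEdges_mono (subset_insert _ _)).trans hσ)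
      have h3 := (mul_le_mul_of_nonneg_right h2 (abs_nonneg _)).trans h1
      have h4 : |𝔼 φ, weightedHom T u (cliqueEdges (insert j I)) φ| ≤ (δ + S * κ) / π := by
        rw [le_div_iff₀ hπ0, mul_comm]
        exact h3
      refine h4.trans ?_
      have h5 : (δ + S * κ) / π ≤ (1 + S) / π * (δ + κ) := by
        rw [div_mul_eq_mul_div]
        refine div_le_div_of_nonneg_right ?_ hπ0.le
        nlinarith [mul_nonneg hS0 hδ]
      rw [hM, add_mul, one_mul]
      linarith
  have hlin : ∀ u : W → V → ℝ, (∀ w x, |u w x| ≤ 1) →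
      |∑ e, c e * 𝔼 φ, weightedHom T u {e} φ| ≤ L * (δ + κ) := by
    intro u hu
    have h1 := hA.abs_sum_relabelCoeff_le hu
    have hsub : (univ.powersetCard 1 : Finset (Finset (Sym2 W))) ⊆ univ.filter Finset.Nonempty := by
      intro F hF
      rw [mem_powersetCard] at hF
      simp only [mem_filter, mem_univ, true_and]
      exact card_pos.1 (by omega)
    rw [← sum_sdiff hsub, powersetCard_one, sum_map] at h1
    have h2 : |∑ F ∈ (univ.filter Finset.Nonempty) \ univ.map ⟨_, singleton_injective⟩,
        relabelCoeff E p F * 𝔼 φ, weightedHom T u F φ| ≤ S * (M * (δ + κ)) := by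
      rw [hS, sum_mul]
      refine (abs_sum_le_sum_abs _ _).trans ((sum_le_sum fun F hF => ?_).trans
        (sum_le_sum_of_subset_of_nonneg (subset_univ _) fun F _ _ =>
          mul_nonneg (hc0 F) (by positivity)))
      rw [abs_mul, abs_of_nonneg (hc0 F)]
      rcases eq_or_ne (relabelCoeff E p F) 0 with h0 | h0
      · simp [h0]
      refine mul_le_mul_of_nonneg_left (hnonlin u hu F ?_ h0) (hc0 F)
      rw [Finset.mem_sdiff, Finset.mem_filter] at hF
      refine lt_of_le_of_ne (card_pos.2 hF.1.2) fun h => hF.2 ?_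
      obtain ⟨e, rfl⟩ := card_eq_one.1 h.symm
      simp
    have h3 := abs_sub_abs_le_abs_sub (∑ e, c e * 𝔼 φ, weightedHom T u {e} φ)
      (-∑ F ∈ (univ.filter Finset.Nonempty) \ univ.map ⟨_, singleton_injective⟩,
        relabelCoeff E p F * 𝔼 φ, weightedHom T u F φ)
    rw [abs_neg, sub_neg_eq_add, add_comm (∑ e, _)] at h3
    have h4 : |∑ e, c e * 𝔼 φ, weightedHom T u {e} φ| ≤ δ + S * (M * (δ + κ)) := by
      have := h3.trans h1
      linarith
    rw [hL, add_mul, one_mul, mul_assoc]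
    linarith
  obtain ⟨a, b, hab⟩ := exists_pair_ne W
  obtain ⟨σ, hσ⟩ := exists_perm_mem_image hE hne hab
  intro f g hf hg
  refine (abs_pairing_le_of_abs_sum_singleton_le (fun e => hc0 {e})
    (fun e he => hdiag _ he e (mem_singleton_self _)) hπ0 hab
    (pow_card_le_relabelCoeff hp0.le hp1 (singleton_subset_iff.2 hσ)) (by positivity) hlin
    hf hg).trans (le_of_eq ?_)
  change (L * (δ + κ) + S' * (L * (δ + κ) / π + (L * (δ + κ) + S' * (L * (δ + κ) / π)) / π)) / π = _
  ring

/-- Once the cut distance to `p` is below a suitable constant, the count property with error `δ`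
improves it to a constant multiple of `δ`. -/
theorem exists_abs_pairing_le_of_abs_pairing_le [Nontrivial W] {E : Finset (Sym2 W)}
    (hE : ∀ e ∈ E, ¬ e.IsDiag) (hne : E.Nonempty) {p : ℝ} (hp0 : 0 < p) (hp1 : p ≤ 1) :
    ∃ C η : ℝ, 0 < C ∧ 0 < η ∧ ∀ (V : Type u) [Fintype V] [Nonempty V] (A : Sym2 V → ℝ),
      (∀ e, 0 ≤ A e) → (∀ e, A e ≤ 1) → ∀ δ : ℝ, SymmetricCount E p δ A →
      (∀ f g : V → ℝ, (∀ x, |f x| ≤ 1) → (∀ x, |g x| ≤ 1) →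
        |pairing (fun e => A e - p) f g| ≤ η) →
      ∀ f g : V → ℝ, (∀ x, |f x| ≤ 1) → (∀ x, |g x| ≤ 1) →
        |pairing (fun e => A e - p) f g| ≤ C * δ := by
  obtain ⟨C₁, hC₁, h₁⟩ := exists_expect_sq_le.{u} hE hne hp0 hp1
  obtain ⟨C₂, hC₂, h₂⟩ := exists_abs_pairing_le_of_expect_sq_le.{u} hE hne hp0 hp1
  set D : ℝ := C₂ * (1 + C₁) with hD
  have hD0 : 0 < D := by positivity
  refine ⟨2 * D, 1 / (2 * D), by positivity, by positivity, ?_⟩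
  intro V _ _ A hA0 hA1 δ hA hη
  have hδ : 0 ≤ δ := (abs_nonneg _).trans (hA 0 (by simp))
  -- the supremum `ε` of the pairings satisfies `ε ≤ D (δ + ε ^ 2)`
  let B : Set ℝ := {t | ∃ f g : V → ℝ, (∀ x, |f x| ≤ 1) ∧ (∀ x, |g x| ≤ 1) ∧
    t = |pairing (fun e => A e - p) f g|}
  have hBne : B.Nonempty := ⟨_, 0, 0, by simp, by simp, rfl⟩
  have hBub : ∀ t ∈ B, t ≤ 1 / (2 * D) := by
    rintro t ⟨f, g, hf, hg, rfl⟩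
    exact hη f g hf hg
  have hBdd : BddAbove B := ⟨_, hBub⟩
  set ε := sSup B with hε
  have hεη : ε ≤ 1 / (2 * D) := csSup_le hBne hBub
  have hle : ∀ f g : V → ℝ, (∀ x, |f x| ≤ 1) → (∀ x, |g x| ≤ 1) →
      |pairing (fun e => A e - p) f g| ≤ ε := fun f g hf hg => le_csSup hBdd ⟨f, g, hf, hg, rfl⟩
  have hε0 : 0 ≤ ε := (abs_nonneg _).trans (hle 0 0 (by simp) (by simp))
  have hboot : ε ≤ D * (δ + ε ^ 2) := by
    refine csSup_le hBne ?_
    rintro t ⟨f, g, hf, hg, rfl⟩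
    refine (h₂ V A hA0 hA1 δ _ hA (h₁ V A hA0 hA1 δ ε hA hle) f g hf hg).trans ?_
    rw [hD, mul_assoc]
    refine mul_le_mul_of_nonneg_left ?_ hC₂.le
    nlinarith [sq_nonneg ε]
  have hεε : D * ε ^ 2 ≤ ε / 2 := by
    have h1 : ε * (2 * D) ≤ 1 := (le_div_iff₀ (by positivity)).1 hεη
    nlinarith
  intro f g hf hg
  refine (hle f g hf hg).trans ?_
  linarith

/-! ### Regular tuples of weights -/

lemma pairing_add_add (K : Sym2 V → ℝ) (f f' g g' : V → ℝ) :
    pairing K (fun x => f x + f' x) (fun x => g x + g' x) =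
      pairing K f g + pairing K f g' + (pairing K f' g + pairing K f' g') := by
  simp only [pairing, ← expect_add_distrib]
  refine expect_congr rfl fun x _ => expect_congr rfl fun y _ => ?_
  ring

lemma pairing_sub_const (K : Sym2 V → ℝ) (q : ℝ) (f g : V → ℝ) :
    pairing (fun e => K e - q) f g = pairing K f g - q * ((𝔼 x, f x) * 𝔼 x, g x) := by
  simp only [pairing, sub_mul, expect_sub_distrib, expect_mul_expect, ← mul_expect]

lemma abs_pairing_le {K : Sym2 V → ℝ} (hK : ∀ e, |K e| ≤ 1) {f g : V → ℝ} (hf : ∀ x, 0 ≤ f x)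
    (hg : ∀ x, 0 ≤ g x) : |pairing K f g| ≤ (𝔼 x, f x) * 𝔼 x, g x := by
  rw [pairing, expect_mul_expect]
  refine (abs_expect_le _ _).trans (expect_le_expect fun x _ => ?_)
  refine (abs_expect_le _ _).trans (expect_le_expect fun y _ => ?_)
  rw [abs_mul, abs_of_nonneg (mul_nonneg (hf x) (hg y))]
  exact mul_le_of_le_one_left (mul_nonneg (hf x) (hg y)) (hK _)

/-- The pair of weights `u`, `w` is `κ`-regular with density `q` for the kernel `K`: tested against
functions below `u` and `w`, the kernel behaves like the constant `q`, with an error that is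
relative to the masses of `u` and `w`. -/
def RegularPair (K : Sym2 V → ℝ) (κ q : ℝ) (u w : V → ℝ) : Prop :=
  ∀ f g : V → ℝ, (∀ x, 0 ≤ f x) → (∀ x, f x ≤ u x) → (∀ x, 0 ≤ g x) → (∀ x, g x ≤ w x) →
    |pairing (fun e => K e - q) f g| ≤ κ * ((𝔼 x, u x) * 𝔼 x, w x)

lemma RegularPair.symm {K : Sym2 V → ℝ} {κ q : ℝ} {u w : V → ℝ} (h : RegularPair K κ q u w) :
    RegularPair K κ q w u := by
  intro f g hf hf' hg hg'
  rw [pairing_comm, mul_comm (𝔼 x, w x)]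
  exact h g f hg hg' hf hf'

lemma RegularPair.mono {K : Sym2 V → ℝ} {κ κ' c q : ℝ} {u w u' w' : V → ℝ}
    (h : RegularPair K κ' q u w) (hu : ∀ x, u' x ≤ u x) (hw : ∀ x, w' x ≤ w x)
    (hu0 : 0 ≤ 𝔼 x, u x) (hw0 : 0 ≤ 𝔼 x, w x) (hc : 0 ≤ c) (hκ : 0 ≤ κ)
    (hcu : c * 𝔼 x, u x ≤ 𝔼 x, u' x) (hcw : c * 𝔼 x, w x ≤ 𝔼 x, w' x) (hκκ : κ' ≤ κ * c ^ 2) :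
    RegularPair K κ q u' w' := by
  intro f g hf hf' hg hg'
  refine (h f g hf (fun x => (hf' x).trans (hu x)) hg fun x => (hg' x).trans (hw x)).trans ?_
  calc κ' * ((𝔼 x, u x) * 𝔼 x, w x) ≤ κ * c ^ 2 * ((𝔼 x, u x) * 𝔼 x, w x) :=
        mul_le_mul_of_nonneg_right hκκ (mul_nonneg hu0 hw0)
    _ = κ * ((c * 𝔼 x, u x) * (c * 𝔼 x, w x)) := by ring
    _ ≤ _ := mul_le_mul_of_nonneg_left (mul_le_mul hcu hcw (mul_nonneg hc hw0)
        ((mul_nonneg hc hu0).trans hcu)) hκ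

/-- If a pair of weights is not `κ`-regular, then its density increases by `κ / 3` on a pair of
weights that is smaller by a factor of at most `κ / 3`. -/
lemma exists_density_increment {K : Sym2 V → ℝ} (hK0 : ∀ e, 0 ≤ K e) (hK1 : ∀ e, K e ≤ 1)
    {κ : ℝ} (hκ : 0 < κ) {u w : V → ℝ} (hu0 : 0 < 𝔼 x, u x) (hw0 : 0 < 𝔼 x, w x)
    {q : ℝ} (hq0 : 0 ≤ q) (hq1 : q ≤ 1)
    (hq : pairing K u w = q * ((𝔼 x, u x) * 𝔼 x, w x)) (hreg : ¬ RegularPair K κ q u w) :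
    ∃ f g : V → ℝ, (∀ x, 0 ≤ f x) ∧ (∀ x, f x ≤ u x) ∧ (∀ x, 0 ≤ g x) ∧ (∀ x, g x ≤ w x) ∧
      κ / 3 * 𝔼 x, u x ≤ 𝔼 x, f x ∧ κ / 3 * 𝔼 x, w x ≤ 𝔼 x, g x ∧
      (q + κ / 3) * ((𝔼 x, f x) * 𝔼 x, g x) ≤ pairing K f g := by
  have hK : ∀ e, |K e - q| ≤ 1 := fun e => by
    rw [abs_le]
    constructor <;> linarith [hK0 e, hK1 e]
  set T : Sym2 V → ℝ := fun e => K e - q with hT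
  set m := (𝔼 x, u x) * 𝔼 x, w x with hm
  have hm0 : 0 < m := mul_pos hu0 hw0
  suffices h : ∃ f g : V → ℝ, (∀ x, 0 ≤ f x) ∧ (∀ x, f x ≤ u x) ∧ (∀ x, 0 ≤ g x) ∧
      (∀ x, g x ≤ w x) ∧ κ / 3 * m ≤ pairing T f g by
    obtain ⟨f, g, hf, hf', hg, hg', h⟩ := h
    have hfu : 𝔼 x, f x ≤ 𝔼 x, u x := expect_le_expect fun x _ => hf' x
    have hgw : 𝔼 x, g x ≤ 𝔼 x, w x := expect_le_expect fun x _ => hg' x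
    have hf0 : 0 ≤ 𝔼 x, f x := expect_nonneg fun x _ => hf x
    have hg0 : 0 ≤ 𝔼 x, g x := expect_nonneg fun x _ => hg x
    have h1 := h.trans ((le_abs_self _).trans (abs_pairing_le hK hf hg))
    refine ⟨f, g, hf, hf', hg, hg', ?_, ?_, ?_⟩
    · refine le_of_mul_le_mul_right ?_ hw0
      calc κ / 3 * (𝔼 x, u x) * 𝔼 x, w x = κ / 3 * m := by rw [hm]; ring
        _ ≤ _ := h1.trans (mul_le_mul_of_nonneg_left hgw hf0)
    · refine le_of_mul_le_mul_left ?_ hu0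
      calc (𝔼 x, u x) * (κ / 3 * 𝔼 x, w x) = κ / 3 * m := by rw [hm]; ring
        _ ≤ _ := h1.trans (mul_le_mul_of_nonneg_right hfu hg0)
    · rw [hT, pairing_sub_const] at h
      have h2 : κ / 3 * ((𝔼 x, f x) * 𝔼 x, g x) ≤ κ / 3 * m :=
        mul_le_mul_of_nonneg_left (mul_le_mul hfu hgw hg0 hu0.le) (by positivity)
      linarith
  unfold RegularPair at hreg
  push Not at hreg
  obtain ⟨f, g, hf, hf', hg, hg', h⟩ := hreg
  -- the four products of `f`, `u - f` with `g`, `w - g` sum to zero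
  have hsum := pairing_add_add T f (fun x => u x - f x) g (fun x => w x - g x)
  simp only [add_sub_cancel] at hsum
  have hzero : pairing T u w = 0 := by rw [hT, pairing_sub_const, hq, sub_self]
  change pairing T u w = _ at hsum
  rw [hzero] at hsum
  have hcf : ∀ x, 0 ≤ u x - f x := fun x => sub_nonneg.2 (hf' x)
  have hcf' : ∀ x, u x - f x ≤ u x := fun x => by linarith [hf x]
  have hcg : ∀ x, 0 ≤ w x - g x := fun x => sub_nonneg.2 (hg' x)
  have hcg' : ∀ x, w x - g x ≤ w x := fun x => by linarith [hg x]
  by_contra! hno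
  have h1 := hno f g hf hf' hg hg'
  have h2 := hno f _ hf hf' hcg hcg'
  have h3 := hno _ g hcf hcf' hg hg'
  have h4 := hno _ _ hcf hcf' hcg hcg'
  rcases lt_abs.1 h with h | h
  · have : 0 < κ * m := by positivity
    linarith
  · linarith

lemma exists_regularPair_aux {K : Sym2 V → ℝ} (hK0 : ∀ e, 0 ≤ K e) (hK1 : ∀ e, K e ≤ 1)
    {κ : ℝ} (hκ : 0 < κ) (hκ1 : κ ≤ 1) (k : ℕ) : ∀ {u w : V → ℝ}, (∀ x, 0 ≤ u x) →
    (∀ x, 0 ≤ w x) → 0 < 𝔼 x, u x → 0 < 𝔼 x, w x → ∀ {d : ℝ}, 1 - k * (κ / 3) < d →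
    d * ((𝔼 x, u x) * 𝔼 x, w x) ≤ pairing K u w →
    ∃ (u' w' : V → ℝ) (q : ℝ), (∀ x, 0 ≤ u' x) ∧ (∀ x, u' x ≤ u x) ∧ (∀ x, 0 ≤ w' x) ∧
      (∀ x, w' x ≤ w x) ∧ (κ / 3) ^ k * 𝔼 x, u x ≤ 𝔼 x, u' x ∧
      (κ / 3) ^ k * 𝔼 x, w x ≤ 𝔼 x, w' x ∧ d ≤ q ∧ 0 ≤ q ∧ q ≤ 1 ∧ RegularPair K κ q u' w' := by
  have hK : ∀ e, |K e| ≤ 1 := fun e => by rw [abs_of_nonneg (hK0 e)]; exact hK1 e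
  induction k with
  | zero =>
    intro u w hu hw hu0 hw0 d hd h
    have h1 := h.trans ((le_abs_self _).trans (abs_pairing_le hK hu hw))
    have h2 : 0 < (𝔼 x, u x) * 𝔼 x, w x := mul_pos hu0 hw0
    simp only [Nat.cast_zero, zero_mul, sub_zero] at hd
    nlinarith
  | succ k ih =>
    intro u w hu hw hu0 hw0 d hd h
    have hm0 : 0 < (𝔼 x, u x) * 𝔼 x, w x := mul_pos hu0 hw0
    set q := pairing K u w / ((𝔼 x, u x) * 𝔼 x, w x) with hqdef
    have hq : pairing K u w = q * ((𝔼 x, u x) * 𝔼 x, w x) := by rw [hqdef]; field_simp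
    have hq0 : 0 ≤ q := div_nonneg (expect_nonneg fun x _ => expect_nonneg fun y _ =>
      mul_nonneg (hK0 _) (mul_nonneg (hu x) (hw y))) hm0.le
    have hq1 : q ≤ 1 := (div_le_one hm0).2 ((le_abs_self _).trans (abs_pairing_le hK hu hw))
    have hdq : d ≤ q := (le_div_iff₀ hm0).2 h
    by_cases hreg : RegularPair K κ q u w
    · have hpow : (κ / 3) ^ (k + 1) ≤ 1 := pow_le_one₀ (by positivity) (by linarith)
      exact ⟨u, w, q, hu, fun _ => le_rfl, hw, fun _ => le_rfl,
        mul_le_of_le_one_left hu0.le hpow, mul_le_of_le_one_left hw0.le hpow, hdq, hq0, hq1, hreg⟩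
    · obtain ⟨f, g, hf, hf', hg, hg', hfu, hgw, hfg⟩ :=
        exists_density_increment hK0 hK1 hκ hu0 hw0 hq0 hq1 hq hreg
      push_cast at hd
      obtain ⟨u', w', q', h1, h2, h3, h4, h5, h6, h7, h8, h9, h10⟩ := ih hf hg
        (lt_of_lt_of_le (by positivity) hfu) (lt_of_lt_of_le (by positivity) hgw)
        (d := q + κ / 3) (by linarith) hfg
      have hκk : 0 ≤ (κ / 3) ^ k := by positivity
      refine ⟨u', w', q', h1, fun x => (h2 x).trans (hf' x), h3, fun x => (h4 x).trans (hg' x),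
        ?_, ?_, by linarith, h8, h9, h10⟩
      · rw [pow_succ, mul_assoc]
        exact (mul_le_mul_of_nonneg_left hfu hκk).trans h5
      · rw [pow_succ, mul_assoc]
        exact (mul_le_mul_of_nonneg_left hgw hκk).trans h6

/-- Inside every pair of weights there is a regular pair of proportional mass, whose density is at
least that of the original pair. -/
lemma exists_regularPair {κ : ℝ} (hκ : 0 < κ) :
    ∃ c : ℝ, 0 < c ∧ c ≤ 1 ∧ ∀ (V : Type u) [Fintype V] (K : Sym2 V → ℝ), (∀ e, 0 ≤ K e) →
      (∀ e, K e ≤ 1) → ∀ u w : V → ℝ, (∀ x, 0 ≤ u x) → (∀ x, 0 ≤ w x) → 0 < 𝔼 x, u x →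
      0 < 𝔼 x, w x → ∀ d : ℝ, 0 ≤ d → d * ((𝔼 x, u x) * 𝔼 x, w x) ≤ pairing K u w →
      ∃ (u' w' : V → ℝ) (q : ℝ), (∀ x, 0 ≤ u' x) ∧ (∀ x, u' x ≤ u x) ∧ (∀ x, 0 ≤ w' x) ∧
        (∀ x, w' x ≤ w x) ∧ c * 𝔼 x, u x ≤ 𝔼 x, u' x ∧ c * 𝔼 x, w x ≤ 𝔼 x, w' x ∧
        d ≤ q ∧ 0 ≤ q ∧ q ≤ 1 ∧ RegularPair K κ q u' w' := by
  set κ' := min κ 1 with hκ'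
  have hκ'0 : 0 < κ' := lt_min hκ one_pos
  obtain ⟨k, hk⟩ := exists_nat_gt (3 / κ')
  have hk1 : 1 < k * (κ' / 3) := by
    rw [div_lt_iff₀ hκ'0] at hk
    linarith
  have hκ'1 : κ' ≤ 1 := min_le_right _ _
  refine ⟨(κ' / 3) ^ k, by positivity, pow_le_one₀ (by positivity) (by linarith), ?_⟩
  intro V _ K hK0 hK1 u w hu hw hu0 hw0 d hd h
  obtain ⟨u', w', q, h1, h2, h3, h4, h5, h6, h7, h8, h9, h10⟩ :=
    exists_regularPair_aux hK0 hK1 hκ'0 hκ'1 k hu hw hu0 hw0 (d := d) (by linarith) h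
  refine ⟨u', w', q, h1, h2, h3, h4, h5, h6, h7, h8, h9, fun f g hf hf' hg hg' => ?_⟩
  refine (h10 f g hf hf' hg hg').trans (mul_le_mul_of_nonneg_right (min_le_left _ _) ?_)
  exact mul_nonneg (expect_nonneg fun x _ => h1 x) (expect_nonneg fun x _ => h3 x)

lemma exists_regular_tuple {ι : Type*} [DecidableEq ι] (P : Finset (ι × ι))
    (hP : ∀ z ∈ P, z.1 ≠ z.2) {κ : ℝ} (hκ : 0 < κ) :
    ∃ c : ℝ, 0 < c ∧ c ≤ 1 ∧ ∀ (V : Type u) [Fintype V] (K : Sym2 V → ℝ), (∀ e, 0 ≤ K e) →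
      (∀ e, K e ≤ 1) → ∀ u : ι → V → ℝ, (∀ i x, 0 ≤ u i x) → (∀ i, 0 < 𝔼 x, u i x) →
      ∃ u' : ι → V → ℝ, (∀ i x, 0 ≤ u' i x) ∧ (∀ i x, u' i x ≤ u i x) ∧
        (∀ i, c * 𝔼 x, u i x ≤ 𝔼 x, u' i x) ∧
        ∀ z ∈ P, ∃ q : ℝ, 0 ≤ q ∧ q ≤ 1 ∧ RegularPair K κ q (u' z.1) (u' z.2) := by
  induction P using Finset.induction_on with
  | empty =>
    refine ⟨1, one_pos, le_rfl, fun V _ K _ _ u hu hu0 =>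
      ⟨u, hu, fun _ _ => le_rfl, fun i => by rw [one_mul], by simp⟩⟩
  | insert z P hz ih =>
    obtain ⟨c, hc, hc1, ih⟩ := ih fun z hz => hP z (mem_insert_of_mem hz)
    obtain ⟨c', hc', hc'1, hpair⟩ := exists_regularPair.{u} (κ := κ * c ^ 2) (by positivity)
    refine ⟨c * c', by positivity, mul_le_one₀ hc1 hc'.le hc'1, ?_⟩
    intro V _ K hK0 hK1 u hu hu0
    obtain ⟨i, j⟩ := z
    have hij : i ≠ j := hP _ (mem_insert_self _ _)
    obtain ⟨f, g, q, hf, hf', hg, hg', hcf, hcg, -, hq0, hq1, hreg⟩ := hpair V K hK0 hK1 (u i) (u j)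
      (hu i) (hu j) (hu0 i) (hu0 j) 0 le_rfl (by
        rw [zero_mul]
        exact expect_nonneg fun x _ => expect_nonneg fun y _ =>
          mul_nonneg (hK0 _) (mul_nonneg (hu _ _) (hu _ _)))
    set u₁ : ι → V → ℝ := update (update u i f) j g with hu₁
    have hval : ∀ k, u₁ k = if k = j then g else if k = i then f else u k := by
      intro k
      simp only [hu₁, update_apply]
    have h0 : ∀ k x, 0 ≤ u₁ k x := by
      intro k x
      rw [hval]
      split_ifs
      exacts [hg x, hf x, hu k x]
    have h1 : ∀ k x, u₁ k x ≤ u k x := by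
      intro k x
      rw [hval]
      split_ifs with h h'
      · exact h ▸ hg' x
      · exact h' ▸ hf' x
      · exact le_rfl
    have h2 : ∀ k, c' * 𝔼 x, u k x ≤ 𝔼 x, u₁ k x := by
      intro k
      rw [hval]
      split_ifs with h h'
      · exact h ▸ hcg
      · exact h' ▸ hcf
      · exact mul_le_of_le_one_left (hu0 k).le hc'1
    have h3 : ∀ k, 0 < 𝔼 x, u₁ k x := fun k => lt_of_lt_of_le (mul_pos hc' (hu0 k)) (h2 k)
    obtain ⟨u', hu', hu'', hcu', hP'⟩ := ih V K hK0 hK1 u₁ h0 h3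
    refine ⟨u', hu', fun k x => (hu'' k x).trans (h1 k x), fun k => ?_, ?_⟩
    · rw [mul_assoc]
      exact (mul_le_mul_of_nonneg_left (h2 k) hc.le).trans (hcu' k)
    · intro z hz
      rcases mem_insert.1 hz with rfl | hz
      · have hi : u₁ i = f := by rw [hval, if_neg hij, if_pos rfl]
        have hj : u₁ j = g := by rw [hval, if_pos rfl]
        rw [← hi, ← hj] at hreg
        exact ⟨q, hq0, hq1, hreg.mono (hu'' i) (hu'' j) (h3 i).le (h3 j).le hc.le hκ.le (hcu' i)
          (hcu' j) le_rfl⟩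
      · exact hP' z hz

/-- A kernel that is not close to `p` has regular tuples of any length, of masses bounded below, for
which the density of the first pair is not close to `p`. -/
lemma exists_regular_tuple_of_le_abs_pairing {p η κ : ℝ} (hp0 : 0 ≤ p) (hp1 : p ≤ 1) (hη : 0 < η)
    (hκ : 0 < κ) (N : ℕ) :
    ∃ c : ℝ, 0 < c ∧ ∀ (V : Type u) [Fintype V] [Nonempty V] (K : Sym2 V → ℝ), (∀ e, 0 ≤ K e) →
      (∀ e, K e ≤ 1) → ∀ f g : V → ℝ, (∀ x, 0 ≤ f x) → (∀ x, f x ≤ 1) → (∀ x, 0 ≤ g x) →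
      (∀ x, g x ≤ 1) → η ≤ |pairing (fun e => K e - p) f g| →
      ∃ (u : ℕ → V → ℝ) (Q : Sym2 ℕ → ℝ), (∀ i x, 0 ≤ u i x) ∧ (∀ i x, u i x ≤ 1) ∧
        (∀ i, c ≤ 𝔼 x, u i x) ∧ (∀ e, 0 ≤ Q e) ∧ (∀ e, Q e ≤ 1) ∧ η ≤ |Q s(0, 1) - p| ∧
        ∀ i j, i ≠ j → i < N → j < N → RegularPair K κ (Q s(i, j)) (u i) (u j) := by
  let P : Finset (ℕ × ℕ) := (range N ×ˢ range N).filter fun z => z.1 < z.2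
  obtain ⟨c, hc, hc1, htuple⟩ := exists_regular_tuple.{u} P
    (fun z hz => (mem_filter.1 hz).2.ne) hκ
  obtain ⟨c', hc', hc'1, hpair⟩ := exists_regularPair.{u} (κ := κ * c ^ 2) (by positivity)
  refine ⟨min (c * (c' * η)) c, by positivity, ?_⟩
  intro V _ _ K hK0 hK1 f g hf hf1 hg hg1 hfg
  have hK : ∀ e, |K e - p| ≤ 1 := fun e => by
    rw [abs_le]
    constructor <;> linarith [hK0 e, hK1 e]
  have hf0 : 0 ≤ 𝔼 x, f x := expect_nonneg fun x _ => hf x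
  have hg0 : 0 ≤ 𝔼 x, g x := expect_nonneg fun x _ => hg x
  have hfle : 𝔼 x, f x ≤ 1 := expect_le univ_nonempty fun x _ => hf1 x
  have hgle : 𝔼 x, g x ≤ 1 := expect_le univ_nonempty fun x _ => hg1 x
  have hmass := hfg.trans (abs_pairing_le hK hf hg)
  have hfη : η ≤ 𝔼 x, f x := hmass.trans (mul_le_of_le_one_right hf0 hgle)
  have hgη : η ≤ 𝔼 x, g x := hmass.trans (mul_le_of_le_one_left hg0 hfle)
  have hfg1 : (𝔼 x, f x) * 𝔼 x, g x ≤ 1 := mul_le_one₀ hfle hg0 hgle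
  -- a regular pair whose density is far from `p`; if the density is low, pass to `1 - K`
  obtain ⟨f', g', q, hf', hff, hg', hgg, hcf, hcg, hqp, hq0, hq1, hreg⟩ :
      ∃ (f' g' : V → ℝ) (q : ℝ), (∀ x, 0 ≤ f' x) ∧ (∀ x, f' x ≤ f x) ∧ (∀ x, 0 ≤ g' x) ∧
        (∀ x, g' x ≤ g x) ∧ c' * 𝔼 x, f x ≤ 𝔼 x, f' x ∧ c' * 𝔼 x, g x ≤ 𝔼 x, g' x ∧
        η ≤ |q - p| ∧ 0 ≤ q ∧ q ≤ 1 ∧ RegularPair K (κ * c ^ 2) q f' g' := by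
    have hη1 : η * ((𝔼 x, f x) * 𝔼 x, g x) ≤ η := mul_le_of_le_one_right hη.le hfg1
    rw [pairing_sub_const] at hfg
    rcases le_abs.1 hfg with h | h
    · obtain ⟨f', g', q, h1, h2, h3, h4, h5, h6, h7, h8, h9, h10⟩ := hpair V K hK0 hK1 f g hf hg
        (by linarith) (by linarith) (p + η) (by linarith) (by linarith)
      exact ⟨f', g', q, h1, h2, h3, h4, h5, h6, le_abs.2 (Or.inl (by linarith)), h8, h9, h10⟩
    · have hcompl : ∀ (q : ℝ) (f g : V → ℝ), pairing (fun e => (1 - K e) - (1 - q)) f g =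
          -pairing (fun e => K e - q) f g := by
        intro q f g
        rw [pairing, pairing, ← expect_neg_distrib]
        refine expect_congr rfl fun x _ => ?_
        rw [← expect_neg_distrib]
        refine expect_congr rfl fun y _ => ?_
        ring
      have h0 := hcompl p f g
      rw [pairing_sub_const (fun e => 1 - K e), pairing_sub_const K] at h0
      obtain ⟨f', g', q, h1, h2, h3, h4, h5, h6, h7, h8, h9, h10⟩ := hpair V (fun e => 1 - K e)
        (fun e => sub_nonneg.2 (hK1 e)) (fun e => by linarith [hK0 e]) f g hf hg
        (by linarith) (by linarith) (1 - p + η) (by linarith) (by linarith)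
      refine ⟨f', g', 1 - q, h1, h2, h3, h4, h5, h6, le_abs.2 (Or.inr (by linarith)),
        by linarith, by linarith, fun a b ha ha' hb hb' => ?_⟩
      have h11 := h10 a b ha ha' hb hb'
      have h12 := hcompl (1 - q) a b
      rw [sub_sub_cancel] at h12
      rwa [h12, abs_neg] at h11
  let u₀ : ℕ → V → ℝ := fun i => if i = 0 then f' else if i = 1 then g' else fun _ => 1
  have hu₀ : ∀ i x, 0 ≤ u₀ i x := by
    intro i x
    dsimp only [u₀]
    split_ifs
    exacts [hf' x, hg' x, zero_le_one]
  have hu₀1 : ∀ i x, u₀ i x ≤ 1 := by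
    intro i x
    dsimp only [u₀]
    split_ifs
    exacts [(hff x).trans (hf1 x), (hgg x).trans (hg1 x), le_rfl]
  have hm₀ : ∀ i, min (c' * η) 1 ≤ 𝔼 x, u₀ i x := by
    intro i
    dsimp only [u₀]
    split_ifs
    · exact (min_le_left _ _).trans ((mul_le_mul_of_nonneg_left hfη hc'.le).trans hcf)
    · exact (min_le_left _ _).trans ((mul_le_mul_of_nonneg_left hgη hc'.le).trans hcg)
    · rw [expect_const univ_nonempty]
      exact min_le_right _ _
  have hpos : ∀ i, 0 < 𝔼 x, u₀ i x := fun i => lt_of_lt_of_le (by positivity) (hm₀ i)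
  obtain ⟨u, hu, huu, hcu, hP⟩ := htuple V K hK0 hK1 u₀ hu₀ hpos
  have hQ : ∀ e : Sym2 ℕ, ∃ q : ℝ, 0 ≤ q ∧ q ≤ 1 ∧ (e = s(0, 1) → η ≤ |q - p|) ∧
      ∀ i j, e = s(i, j) → i ≠ j → i < N → j < N → RegularPair K κ q (u i) (u j) := by
    have h01 : RegularPair K κ q (u 0) (u 1) := by
      have hreg' : RegularPair K (κ * c ^ 2) q (u₀ 0) (u₀ 1) := hreg
      exact hreg'.mono (huu 0) (huu 1) (hpos 0).le (hpos 1).le hc.le hκ.le (hcu 0) (hcu 1) le_rfl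
    have hlt : ∀ a b, a < b → ∃ q : ℝ, 0 ≤ q ∧ q ≤ 1 ∧ (s(a, b) = s(0, 1) → η ≤ |q - p|) ∧
        ∀ i j, s(a, b) = s(i, j) → i ≠ j → i < N → j < N → RegularPair K κ q (u i) (u j) := by
      intro a b hab
      have hsym : ∀ q, (a < N → b < N → RegularPair K κ q (u a) (u b)) → ∀ i j,
          s(a, b) = s(i, j) → i ≠ j → i < N → j < N → RegularPair K κ q (u i) (u j) := by
        intro q h i j hij _ hi hj
        rcases Sym2.eq_iff.1 hij with ⟨rfl, rfl⟩ | ⟨rfl, rfl⟩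
        · exact h hi hj
        · exact (h hj hi).symm
      by_cases h : a = 0 ∧ b = 1
      · obtain ⟨rfl, rfl⟩ := h
        exact ⟨q, hq0, hq1, fun _ => hqp, hsym q fun _ _ => h01⟩
      · have hne : s(a, b) ≠ s(0, 1) := by
          rw [Ne, Sym2.eq_iff]
          omega
        by_cases hN : a < N ∧ b < N
        · obtain ⟨q', hq'0, hq'1, hq'⟩ := hP (a, b) (by simp [P, hN, hab])
          exact ⟨q', hq'0, hq'1, fun h => absurd h hne, hsym q' fun _ _ => hq'⟩
        · exact ⟨0, le_rfl, zero_le_one, fun h => absurd h hne,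
            hsym 0 fun ha hb => absurd ⟨ha, hb⟩ hN⟩
    intro e
    induction e using Sym2.ind with | _ a b =>
    rcases lt_trichotomy a b with hab | rfl | hab
    · exact hlt a b hab
    · refine ⟨0, le_rfl, zero_le_one, fun h => ?_, fun i j h hij => ?_⟩
      · rw [Sym2.eq_iff] at h
        omega
      · rw [Sym2.eq_iff] at h
        omega
    · rw [Sym2.eq_swap]
      exact hlt b a hab
  choose Q hQ0 hQ1 hQp hQreg using hQ
  refine ⟨u, Q, hu, fun i x => (huu i x).trans (hu₀1 i x), fun i => ?_, hQ0, hQ1, hQp _ rfl,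
    fun i j => hQreg _ i j rfl⟩
  refine le_trans ?_ ((mul_le_mul_of_nonneg_left (hm₀ i) hc.le).trans (hcu i))
  rw [mul_min_of_nonneg _ _ hc.le, mul_one]

/-- For a regular tuple, the count property of the kernel passes to the matrix of densities. -/
lemma SymmetricCount.abs_sum_prod_sub_le [Nonempty V] {E : Finset (Sym2 W)}
    (hE : ∀ e ∈ E, ¬ e.IsDiag) {p : ℝ} {K : Sym2 V → ℝ} (hK0 : ∀ e, 0 ≤ K e)
    (hK1 : ∀ e, K e ≤ 1) {δ : ℝ} (hK : SymmetricCount E p δ K) {κ c : ℝ} (hκ : 0 ≤ κ) (hc : 0 < c)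
    {N : ℕ} {u : ℕ → V → ℝ} {Q : Sym2 ℕ → ℝ} (hu : ∀ i x, 0 ≤ u i x) (hu1 : ∀ i x, u i x ≤ 1)
    (hcu : ∀ i, c ≤ 𝔼 x, u i x) (hQ0 : ∀ e, 0 ≤ Q e) (hQ1 : ∀ e, Q e ≤ 1)
    (hreg : ∀ i j, i ≠ j → i < N → j < N → RegularPair K κ (Q s(i, j)) (u i) (u j))
    {ι : W → ℕ} (hι : Injective ι) (hιN : ∀ w, ι w < N) :
    |∑ σ : Equiv.Perm W, (∏ e ∈ E.image (Sym2.map σ), Q (e.map ι) - p ^ #E)| ≤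
      δ / c ^ Fintype.card W + Fintype.card (Equiv.Perm W) * (#E * κ) := by
  set m := ∏ w, 𝔼 x, u (ι w) x with hm
  have hcm : c ^ Fintype.card W ≤ m := by
    rw [← card_univ, ← prod_const]
    exact prod_le_prod (fun _ _ => hc.le) fun w _ => hcu _
  have hc0 : 0 < c ^ Fintype.card W := pow_pos hc _
  have hm0 : 0 < m := hc0.trans_le hcm
  have hδ : 0 ≤ δ := (abs_nonneg _).trans (hK 0 (by simp))
  have h1 := hK (fun w => u (ι w)) fun w x => by rw [abs_of_nonneg (hu _ _)]; exact hu1 _ _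
  have h2 : ∀ σ : Equiv.Perm W, |𝔼 φ, weightedHom K (fun w => u (ι w)) (E.image (Sym2.map σ)) φ -
      (∏ e ∈ E.image (Sym2.map σ), Q (e.map ι)) * m| ≤ #E * κ * m := by
    intro σ
    have h := abs_expect_weightedHom_sub_le hK0 hK1 (q := fun e : Sym2 W => Q (e.map ι))
      (fun e => hQ0 _) (fun e => hQ1 _) (u := fun w => u (ι w)) (fun w x => hu _ _)
      (s := fun w => 𝔼 x, u (ι w) x) (fun w => le_rfl) hκ (E.image (Sym2.map σ))
      (not_isDiag_of_mem_image_perm hE) (by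
        intro i j hij f g hf hf' hg hg'
        have hne : i ≠ j := by simpa using not_isDiag_of_mem_image_perm hE _ hij
        exact hreg (ι i) (ι j) (hι.ne hne) (hιN i) (hιN j) f g hf hf' hg hg')
    rwa [card_image_perm] at h
  have h3 : m * |∑ σ : Equiv.Perm W, (∏ e ∈ E.image (Sym2.map σ), Q (e.map ι) - p ^ #E)| ≤
      δ + Fintype.card (Equiv.Perm W) * (#E * κ * m) := by
    rw [← abs_of_pos hm0, ← abs_mul, abs_of_pos hm0, mul_sum]
    have h4 : ∑ σ : Equiv.Perm W, m * (∏ e ∈ E.image (Sym2.map σ), Q (e.map ι) - p ^ #E) =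
        ∑ σ : Equiv.Perm W,
          (𝔼 φ, weightedHom K (fun w => u (ι w)) (E.image (Sym2.map σ)) φ - p ^ #E * m) -
        ∑ σ : Equiv.Perm W,
          (𝔼 φ, weightedHom K (fun w => u (ι w)) (E.image (Sym2.map σ)) φ -
            (∏ e ∈ E.image (Sym2.map σ), Q (e.map ι)) * m) := by
      rw [← sum_sub_distrib]
      refine sum_congr rfl fun σ _ => ?_
      ring
    rw [h4]
    refine (abs_sub _ _).trans (add_le_add h1 ?_)
    refine (abs_sum_le_sum_abs _ _).trans ((sum_le_card_nsmul univ _ _ fun σ _ => h2 σ).trans ?_)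
    rw [card_univ, nsmul_eq_mul]
  have h5 : |∑ σ : Equiv.Perm W, (∏ e ∈ E.image (Sym2.map σ), Q (e.map ι) - p ^ #E)| ≤
      (δ + Fintype.card (Equiv.Perm W) * (#E * κ * m)) / m := by
    rw [le_div_iff₀ hm0, mul_comm]
    exact h3
  refine h5.trans ?_
  rw [add_div, ← mul_assoc, mul_div_assoc _ m, div_self hm0.ne', mul_one]
  exact add_le_add_left (div_le_div_of_nonneg_left hδ hc0 hcm) _

/-! ### Infinite density matrices -/

/-- The defect of the count equation for the density matrix `Q` on the points `ι w`. -/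
noncomputable def countDefect {X : Type*} (E : Finset (Sym2 W)) (p : ℝ) (Q : Sym2 X → ℝ)
    (ι : W → X) : ℝ :=
  ∑ σ : Equiv.Perm W, (∏ e ∈ E.image (Sym2.map σ), Q (e.map ι) - p ^ #E)

lemma exists_tendsto_ultrafilter (U : Ultrafilter ℕ) {a : ℕ → ℝ} (h0 : ∀ k, 0 ≤ a k)
    (h1 : ∀ k, a k ≤ 1) : ∃ l : ℝ, 0 ≤ l ∧ l ≤ 1 ∧ Tendsto a U (𝓝 l) := by
  obtain ⟨l, hl, h⟩ := (isCompact_Icc (a := (0 : ℝ)) (b := 1)).ultrafilter_le_nhds (U.map a)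
    (by
      rw [le_principal_iff, Ultrafilter.coe_map, Filter.mem_map]
      exact Eventually.of_forall fun k => ⟨h0 k, h1 k⟩)
  exact ⟨l, hl.1, hl.2, h⟩

lemma tendsto_countDefect {X Y : Type*} {E : Finset (Sym2 W)} {p : ℝ} {l : Filter Y}
    {Q : Y → Sym2 X → ℝ} {ι : Y → W → X} {L : Sym2 W → ℝ}
    (h : ∀ e, ¬ e.IsDiag → Tendsto (fun k => Q k (e.map (ι k))) l (𝓝 (L e)))
    (hE : ∀ e ∈ E, ¬ e.IsDiag) :
    Tendsto (fun k => countDefect E p (Q k) (ι k)) l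
      (𝓝 (∑ σ : Equiv.Perm W, (∏ e ∈ E.image (Sym2.map σ), L e - p ^ #E))) :=
  tendsto_finsetSum _ fun _ _ => (tendsto_finsetProd _ fun e he =>
    h e (not_isDiag_of_mem_image_perm hE e he)).sub_const _

/-- The extension of the matrix `Q` by points at infinity: `b i` is the entry between `i` and any
point at infinity, and `q` the entry between two points at infinity. -/
def extendMatrix (Q : Sym2 ℕ → ℝ) (b : ℕ → ℝ) (q : ℝ) : Sym2 (ℕ ⊕ ℕ) → ℝ :=
  Sym2.lift ⟨fun x y => match x, y with
    | Sum.inl i, Sum.inl j => Q s(i, j)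
    | Sum.inl i, Sum.inr _ => b i
    | Sum.inr _, Sum.inl j => b j
    | Sum.inr _, Sum.inr _ => q, by
    rintro (i | i) (j | j)
    · simp only [Sym2.eq_swap]
    all_goals rfl⟩

/-- The count equation extends to the points at infinity, by replacing them one after the other with
limits along the ultrafilter. -/
lemma countDefect_extendMatrix_eq_zero {E : Finset (Sym2 W)} (hE : ∀ e ∈ E, ¬ e.IsDiag) {p : ℝ}
    {Q : Sym2 ℕ → ℝ} (hQ : ∀ ι : W → ℕ, Injective ι → countDefect E p Q ι = 0) {b : ℕ → ℝ} {q : ℝ}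
    (hb : ∀ i, Tendsto (fun j => Q s(i, j)) (hyperfilter ℕ) (𝓝 (b i)))
    (hq : Tendsto b (hyperfilter ℕ) (𝓝 q)) (k : ℕ) :
    ∀ ι : W → ℕ ⊕ ℕ, Injective ι → #{w | (ι w).isRight} = k →
      countDefect E p (extendMatrix Q b q) ι = 0 := by
  induction k with
  | zero =>
    intro ι hι h
    rw [card_eq_zero, filter_eq_empty_iff] at h
    have hleft : ∀ w, ∃ i, ι w = Sum.inl i := by
      intro w
      have := h (mem_univ w)
      rcases hw : ι w with i | i
      · exact ⟨i, rfl⟩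
      · simp [hw] at this
    choose j hj using hleft
    have hjinj : Injective j := fun w w' h => hι (by rw [hj, hj, h])
    rw [← hQ j hjinj]
    unfold countDefect
    refine sum_congr rfl fun σ _ => ?_
    congr 1
    refine prod_congr rfl fun e _ => ?_
    induction e using Sym2.ind with | _ x y =>
    rw [Sym2.map_mk, Sym2.map_mk, hj, hj]
    rfl
  | succ k ih =>
    intro ι hι h
    obtain ⟨a, ha⟩ : ({w | (ι w).isRight} : Finset W).Nonempty := card_pos.1 (by omega)
    obtain ⟨t, ht⟩ : ∃ t, ι a = Sum.inr t := by
      have := (mem_filter.1 ha).2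
      exact Sum.isRight_iff.1 this
    have hev : ∀ᶠ j : ℕ in hyperfilter ℕ,
        countDefect E p (extendMatrix Q b q) (update ι a (Sum.inl j)) = 0 := by
      have hfin : (Sum.inl ⁻¹' Set.range ι : Set ℕ).Finite :=
        (Set.finite_range ι).preimage Sum.inl_injective.injOn
      filter_upwards [hyperfilter_le_cofinite hfin.compl_mem_cofinite] with j hj
      refine ih _ ?_ ?_
      · intro w w' hw
        simp only [update_apply] at hw
        split_ifs at hw with h1 h2 h2
        · rw [h1, h2]
        · exact absurd ⟨w', hw.symm⟩ hj
        · exact absurd ⟨w, hw⟩ hj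
        · exact hι hw
      · have : ({w | (update ι a (Sum.inl j) w).isRight} : Finset W) =
            ({w | (ι w).isRight} : Finset W).erase a := by
          ext w
          simp only [mem_filter, mem_univ, true_and, mem_erase, update_apply]
          split_ifs with hw <;> simp [hw]
        rw [this, card_erase_of_mem ha, h]
        rfl
    have hlim := tendsto_countDefect (p := p) (l := (hyperfilter ℕ : Filter ℕ))
      (Q := fun _ => extendMatrix Q b q) (ι := fun j => update ι a (Sum.inl j))
      (L := fun e => extendMatrix Q b q (e.map ι)) (fun e he => ?_) hE
    · refine tendsto_nhds_unique hlim ((tendsto_congr' ?_).2 tendsto_const_nhds)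
      exact hev
    · have hone : ∀ z, a ≠ z → Tendsto
          (fun j : ℕ => extendMatrix Q b q (s(a, z).map (update ι a (Sum.inl j))))
          (hyperfilter ℕ) (𝓝 (extendMatrix Q b q (s(a, z).map ι))) := by
        intro z haz
        simp only [Sym2.map_mk, update_self, update_of_ne haz.symm, ht]
        rcases ι z with i | i
        · have : Tendsto (fun j => Q s(j, i)) (hyperfilter ℕ) (𝓝 (b i)) := by
            simpa only [Sym2.eq_swap] using hb i
          exact this
        · exact hq
      by_cases hae : a ∈ e
      · obtain ⟨z, rfl⟩ := Sym2.mem_iff_exists.1 hae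
        exact hone z (by simpa using he)
      · simp only [sym2_map_update hae]
        exact tendsto_const_nhds

/-- A matrix satisfying the count equation on all tuples of distinct points is constant: by the
equation at infinity `q = p`, then by monotonicity `b i = p`, and then `Q s(0, 1) = p`. -/
lemma eq_of_countDefect_eq_zero [Nontrivial W] {E : Finset (Sym2 W)} (hE : ∀ e ∈ E, ¬ e.IsDiag)
    (hne : E.Nonempty) {p : ℝ} (hp0 : 0 < p) {Q : Sym2 ℕ → ℝ} (hQ0 : ∀ e, 0 ≤ Q e)
    (hQ1 : ∀ e, Q e ≤ 1) (hQ : ∀ ι : W → ℕ, Injective ι → countDefect E p Q ι = 0) :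
    Q s(0, 1) = p := by
  choose b hb0 hb1 hb using fun i =>
    exists_tendsto_ultrafilter (hyperfilter ℕ) (a := fun j => Q s(i, j)) (fun j => hQ0 _)
      fun j => hQ1 _
  obtain ⟨q, hq0, hq1, hq⟩ := exists_tendsto_ultrafilter (hyperfilter ℕ) hb0 hb1
  have hext : ∀ ι : W → ℕ ⊕ ℕ, Injective ι → countDefect E p (extendMatrix Q b q) ι = 0 :=
    fun ι hι => countDefect_extendMatrix_eq_zero hE hQ hb hq _ ι hι rfl
  let f : W → ℕ := fun w => Fintype.equivFin W w
  have hf : Injective f := fun w w' h => (Fintype.equivFin W).injective (Fin.ext h)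
  have hm : #E ≠ 0 := (card_pos.2 hne).ne'
  have hdiag : ∀ σ : Equiv.Perm W, ∀ x y, s(x, y) ∈ E.image (Sym2.map σ) → x ≠ y :=
    fun σ x y h => by simpa using not_isDiag_of_mem_image_perm hE _ h
  obtain ⟨a, c, hac⟩ := exists_pair_ne W
  have hqp : q = p := by
    have h := hext (fun w => Sum.inr (f w)) fun w w' h => hf (Sum.inr_injective h)
    have h1 : ∀ σ : Equiv.Perm W, ∏ e ∈ E.image (Sym2.map σ),
        extendMatrix Q b q (e.map fun w => Sum.inr (f w)) = q ^ #E := by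
      intro σ
      rw [prod_congr rfl (g := fun _ => q), prod_const, card_image_perm]
      intro e _
      induction e using Sym2.ind with | _ x y => rfl
    simp only [countDefect, h1, sum_const, card_univ, smul_eq_zero, Fintype.card_ne_zero,
      false_or, sub_eq_zero] at h
    exact (pow_left_inj₀ hq0 hp0.le hm).1 h
  have hbp : ∀ i, b i = p := by
    intro i
    have h := hext (update (fun w => Sum.inr (f w)) a (Sum.inl i)) (by
      intro w w' hw
      simp only [update_apply] at hw
      split_ifs at hw with h1 h2
      · rw [h1, h2]
      · exact hf (Sum.inr_injective hw))
    have h1 : ∀ σ : Equiv.Perm W, ∏ e ∈ E.image (Sym2.map σ),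
        extendMatrix Q b q (e.map (update (fun w => Sum.inr (f w)) a (Sum.inl i))) =
          p ^ #E * (b i / p) ^ #{e ∈ E.image (Sym2.map σ) | a ∈ e} := by
      intro σ
      rw [prod_congr rfl (g := fun e => p * if a ∈ e then b i / p else 1), prod_mul_distrib,
        prod_const, card_image_perm, ← prod_filter, prod_const]
      intro e he
      split_ifs with hae
      · obtain ⟨z, rfl⟩ := Sym2.mem_iff_exists.1 hae
        rw [Sym2.map_mk, update_self, update_of_ne (hdiag σ _ _ he).symm]
        change b i = _
        field_simp
      · rw [sym2_map_update hae, mul_one, ← hqp]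
        induction e using Sym2.ind with | _ x y => rfl
    have h2 : p ^ #E * ∑ σ : Equiv.Perm W,
        ((b i / p) ^ #{e ∈ E.image (Sym2.map σ) | a ∈ e} - 1) = 0 := by
      rw [mul_sum, ← h, countDefect]
      refine sum_congr rfl fun σ _ => ?_
      rw [h1]
      ring
    have h3 := (mul_eq_zero.1 h2).resolve_left (pow_pos hp0 _).ne'
    obtain ⟨σ, hσ⟩ := exists_perm_mem_image hE hne hac
    have h4 := abs_sub_one_le_abs_sum_pow_sub_one univ
      (fun σ : Equiv.Perm W => #{e ∈ E.image (Sym2.map σ) | a ∈ e})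
      (div_nonneg (hb0 i) hp0.le) ⟨σ, mem_univ _, (card_pos.2 ⟨s(a, c), by simpa using hσ⟩).ne'⟩
    rw [h3, abs_zero] at h4
    have h5 : b i / p - 1 = 0 := abs_nonpos_iff.1 h4
    field_simp at h5
    linarith
  have h := hext (update (update (fun w => Sum.inr (f w)) a (Sum.inl 0)) c (Sum.inl 1)) (by
    intro w w' hw
    simp only [update_apply] at hw
    split_ifs at hw with h1 h2 h3 h4 h5 h6 h7 <;> simp_all
    exact hf hw)
  have h1 : ∀ σ : Equiv.Perm W, ∏ e ∈ E.image (Sym2.map σ), extendMatrix Q b q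
      (e.map (update (update (fun w => Sum.inr (f w)) a (Sum.inl 0)) c (Sum.inl 1))) - p ^ #E =
        if s(a, c) ∈ E.image (Sym2.map σ) then p ^ (#E - 1) * (Q s(0, 1) - p) else 0 := by
    intro σ
    have hval : ∀ e ∈ E.image (Sym2.map σ), e ≠ s(a, c) → extendMatrix Q b q
        (e.map (update (update (fun w => Sum.inr (f w)) a (Sum.inl 0)) c (Sum.inl 1))) = p := by
      intro e he hec
      induction e using Sym2.ind with | _ x y =>
      have hxy := hdiag σ _ _ he
      rw [Ne, Sym2.eq_iff] at hec
      rw [Sym2.map_mk]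
      simp only [update_apply]
      split_ifs with hx hy hy hx' hy hy hy hy
      · exact absurd (hx.trans hy.symm) hxy
      · exact absurd (Or.inr ⟨hx, hy⟩) hec
      · exact hbp 1
      · exact absurd (Or.inl ⟨hx', hy⟩) hec
      · exact absurd (hx'.trans hy.symm) hxy
      · exact hbp 0
      · exact hbp 1
      · exact hbp 0
      · exact hqp
    split_ifs with hσ
    · rw [← mul_prod_erase _ _ hσ, prod_congr rfl (g := fun _ => p), prod_const,
        card_erase_of_mem hσ, card_image_perm, Sym2.map_mk, update_self, update_of_ne hac,
        update_self]
      · change Q s(0, 1) * p ^ (#E - 1) - p ^ #E = _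
        obtain ⟨m, hm'⟩ := Nat.exists_eq_succ_of_ne_zero hm
        rw [hm', Nat.succ_eq_add_one, Nat.add_sub_cancel, pow_succ]
        ring
      · intro e he
        exact hval e (mem_erase.1 he).2 (mem_erase.1 he).1
    · rw [prod_congr rfl (g := fun _ => p), prod_const, card_image_perm, sub_self]
      intro e he
      exact hval e he fun h => hσ (h ▸ he)
  simp only [countDefect, h1, ← sum_filter, sum_const, smul_eq_zero, card_eq_zero] at h
  obtain ⟨σ, hσ⟩ := exists_perm_mem_image hE hne hac
  rcases h with h | h
  · rw [filter_eq_empty_iff] at h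
    exact absurd hσ (h (mem_univ σ))
  · linarith [(mul_eq_zero.1 h).resolve_left (pow_pos hp0 _).ne']

/-- By compactness, a finite matrix satisfying the count equation approximately has its first entry
close to `p`. -/
lemma exists_forall_abs_sub_lt [Nontrivial W] {E : Finset (Sym2 W)} (hE : ∀ e ∈ E, ¬ e.IsDiag)
    (hne : E.Nonempty) {p : ℝ} (hp0 : 0 < p) {η : ℝ} (hη : 0 < η) :
    ∃ N : ℕ, ∀ Q : Sym2 ℕ → ℝ, (∀ e, 0 ≤ Q e) → (∀ e, Q e ≤ 1) →
      (∀ ι : W → ℕ, Injective ι → (∀ w, ι w < N) →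
        |countDefect E p Q ι| ≤ 1 / ((N : ℝ) + 1)) → |Q s(0, 1) - p| < η := by
  by_contra! hcon
  choose Q hQ0 hQ1 hQ hQη using hcon
  choose Q' hQ'0 hQ'1 hQ' using fun e =>
    exists_tendsto_ultrafilter (hyperfilter ℕ) (a := fun N => Q N e) (fun N => hQ0 N e)
      fun N => hQ1 N e
  have hle : (hyperfilter ℕ : Filter ℕ) ≤ atTop := Nat.cofinite_eq_atTop ▸ hyperfilter_le_cofinite
  have heq : ∀ ι : W → ℕ, Injective ι → countDefect E p Q' ι = 0 := by
    intro ι hι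
    have h1 := tendsto_countDefect (p := p) (l := (hyperfilter ℕ : Filter ℕ)) (Q := Q)
      (ι := fun _ => ι) (L := fun e => Q' (e.map ι)) (fun e _ => hQ' _) hE
    have h2 : Tendsto (fun N => countDefect E p (Q N) ι) (hyperfilter ℕ : Filter ℕ) (𝓝 0) := by
      refine squeeze_zero_norm' ?_ (tendsto_one_div_add_atTop_nhds_zero_nat.mono_left hle)
      obtain ⟨M, hM⟩ := (Set.finite_range ι).bddAbove
      refine hle ((eventually_gt_atTop M).mono fun N hN => ?_)
      exact hQ N ι hι fun w => (hM ⟨w, rfl⟩).trans_lt hN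
    exact tendsto_nhds_unique h1 h2
  have h := eq_of_countDefect_eq_zero hE hne hp0 hQ'0 hQ'1 heq
  have h1 : Tendsto (fun N => |Q N s(0, 1) - p|) (hyperfilter ℕ) (𝓝 |Q' s(0, 1) - p|) :=
    ((hQ' s(0, 1)).sub_const p).abs
  have h2 := ge_of_tendsto h1 (Eventually.of_forall hQη)
  rw [h, sub_self, abs_zero] at h2
  linarith

/-- The qualitative form of the theorem: the count property with a sufficiently small error makes
the cut distance to `p` smaller than any given constant. -/
theorem exists_forall_abs_pairing_le [Nontrivial W] {E : Finset (Sym2 W)}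
    (hE : ∀ e ∈ E, ¬ e.IsDiag) (hne : E.Nonempty) {p : ℝ} (hp0 : 0 < p) (hp1 : p ≤ 1) {η : ℝ}
    (hη : 0 < η) :
    ∃ δ₀ : ℝ, 0 < δ₀ ∧ ∀ (V : Type u) [Fintype V] [Nonempty V] (A : Sym2 V → ℝ),
      (∀ e, 0 ≤ A e) → (∀ e, A e ≤ 1) → ∀ δ : ℝ, δ ≤ δ₀ → SymmetricCount E p δ A →
      ∀ f g : V → ℝ, (∀ x, |f x| ≤ 1) → (∀ x, |g x| ≤ 1) →
        |pairing (fun e => A e - p) f g| ≤ η := by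
  obtain ⟨N, hN⟩ := exists_forall_abs_sub_lt hE hne hp0 (η := η / 4) (by positivity)
  set P : ℝ := (Fintype.card (Equiv.Perm W) : ℝ) with hP
  have hP0 : 0 < P := Nat.cast_pos.2 Fintype.card_pos
  have hm : (0 : ℝ) < #E := Nat.cast_pos.2 (card_pos.2 hne)
  set κ : ℝ := 1 / (2 * (N + 1) * (P * #E)) with hκ
  have hκ0 : 0 < κ := by positivity
  obtain ⟨c, hc, hreg⟩ :=
    exists_regular_tuple_of_le_abs_pairing.{u} hp0.le hp1 (η := η / 4) (by positivity) hκ0 N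
  refine ⟨c ^ Fintype.card W / (2 * (N + 1)), by positivity, ?_⟩
  intro V _ _ A hA0 hA1 δ hδ hA
  -- it suffices to treat test functions with values in `[0, 1]`
  have hpos : ∀ f g : V → ℝ, (∀ x, 0 ≤ f x) → (∀ x, f x ≤ 1) → (∀ x, 0 ≤ g x) → (∀ x, g x ≤ 1) →
      |pairing (fun e => A e - p) f g| ≤ η / 4 := by
    intro f g hf hf1 hg hg1
    by_contra! hlt
    obtain ⟨u, Q, hu, hu1, hcu, hQ0, hQ1, hQη, hQreg⟩ :=
      hreg V A hA0 hA1 f g hf hf1 hg hg1 hlt.le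
    refine absurd (hN Q hQ0 hQ1 fun ι hι hιN => ?_) (not_lt.2 hQη)
    refine (hA.abs_sum_prod_sub_le hE hA0 hA1 hκ0.le hc hu hu1 hcu hQ0 hQ1 hQreg hι hιN).trans ?_
    have h1 : δ / c ^ Fintype.card W ≤ 1 / (2 * ((N : ℝ) + 1)) := by
      rw [div_le_iff₀ (by positivity)]
      refine hδ.trans (le_of_eq ?_)
      ring
    have h2 : P * (#E * κ) = 1 / (2 * ((N : ℝ) + 1)) := by
      rw [hκ]
      field_simp
    have h3 : 1 / ((N : ℝ) + 1) = 1 / (2 * ((N : ℝ) + 1)) + 1 / (2 * ((N : ℝ) + 1)) := by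
      field_simp
      norm_num
    rw [h2, h3]
    linarith
  intro f g hf hg
  have hbd : ∀ f : V → ℝ, (∀ x, |f x| ≤ 1) → (∀ x, 0 ≤ max (f x) 0) ∧ (∀ x, max (f x) 0 ≤ 1) ∧
      (∀ x, 0 ≤ max (-f x) 0) ∧ (∀ x, max (-f x) 0 ≤ 1) := by
    intro f hf
    refine ⟨fun x => le_max_right _ _, fun x => max_le (abs_le.1 (hf x)).2 zero_le_one,
      fun x => le_max_right _ _, fun x => max_le ?_ zero_le_one⟩
    linarith [(abs_le.1 (hf x)).1]
  obtain ⟨f1, f2, f3, f4⟩ := hbd f hf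
  obtain ⟨g1, g2, g3, g4⟩ := hbd g hg
  have hmax : ∀ t : ℝ, t = max t 0 - max (-t) 0 := by
    intro t
    rcases le_total t 0 with h | h
    · rw [max_eq_right h, max_eq_left (by linarith)]
      ring
    · rw [max_eq_left h, max_eq_right (by linarith)]
      ring
  have hsplit : pairing (fun e => A e - p) f g =
      pairing (fun e => A e - p) (fun x => max (f x) 0) (fun x => max (g x) 0) -
      pairing (fun e => A e - p) (fun x => max (f x) 0) (fun x => max (-g x) 0) -
      (pairing (fun e => A e - p) (fun x => max (-f x) 0) (fun x => max (g x) 0) -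
      pairing (fun e => A e - p) (fun x => max (-f x) 0) (fun x => max (-g x) 0)) := by
    simp only [pairing, ← expect_sub_distrib]
    refine expect_congr rfl fun x _ => expect_congr rfl fun y _ => ?_
    conv_lhs => rw [hmax (f x), hmax (g y)]
    ring
  have h1 := abs_le.1 (hpos _ _ f1 f2 g1 g2)
  have h2 := abs_le.1 (hpos _ _ f1 f2 g3 g4)
  have h3 := abs_le.1 (hpos _ _ f3 f4 g1 g2)
  have h4 := abs_le.1 (hpos _ _ f3 f4 g3 g4)
  rw [hsplit, abs_le]
  constructor <;> linarith

/-! ### From copies in subsets to weighted counts -/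

/-- The adjacency matrix of a graph, as a symmetric kernel. -/
noncomputable def adjKernel {V : Type*} (G : SimpleGraph V) : Sym2 V → ℝ :=
  Set.indicator G.edgeSet 1

lemma adjKernel_nonneg (G : SimpleGraph V) (e : Sym2 V) : 0 ≤ adjKernel G e :=
  Set.indicator_nonneg (fun _ _ => zero_le_one) _

lemma adjKernel_le_one (G : SimpleGraph V) (e : Sym2 V) : adjKernel G e ≤ 1 :=
  Set.indicator_le_self' (fun _ _ => zero_le_one) _

lemma labelledCopyCount_eq_natCard {V : Type*} [Fintype V] (G : SimpleGraph V)
    (H : SimpleGraph W) : G.labelledCopyCount H = Nat.card (SimpleGraph.Copy H G) := by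
  classical
  rw [SimpleGraph.labelledCopyCount, Fintype.card_eq_nat_card]

open Classical in
lemma labelledCopyCount_induce (G : SimpleGraph V) (H : SimpleGraph W) (S : Finset V)
    {E : Finset (Sym2 W)} (hE : ∀ e, e ∈ E ↔ e ∈ H.edgeSet) :
    ((G.induce (S : Set V)).labelledCopyCount H : ℝ) =
      ∑ φ : W → V with Injective φ,
        (∏ w, if φ w ∈ S then (1 : ℝ) else 0) * ∏ e ∈ E, adjKernel G (e.map φ) := by
  have h1 : ∀ φ : W → V, (∏ w, if φ w ∈ S then (1 : ℝ) else 0) *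
      ∏ e ∈ E, adjKernel G (e.map φ) =
        if (∀ w, φ w ∈ S) ∧ ∀ a b, H.Adj a b → G.Adj (φ a) (φ b) then 1 else 0 := by
    intro φ
    have ha : (∏ w, if φ w ∈ S then (1 : ℝ) else 0) = if ∀ w, φ w ∈ S then 1 else 0 := by
      rw [Finset.prod_ite_zero]
      simp
    have hb : ∏ e ∈ E, adjKernel G (e.map φ) =
        if ∀ a b, H.Adj a b → G.Adj (φ a) (φ b) then 1 else 0 := by
      simp only [adjKernel, Set.indicator_apply, Pi.one_apply]
      rw [Finset.prod_ite_zero]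
      have : (∀ e ∈ E, e.map φ ∈ G.edgeSet) ↔
          ∀ a b, H.Adj a b → G.Adj (φ a) (φ b) := by
        constructor
        · exact fun h a b hab => h s(a, b) ((hE _).2 hab)
        · intro h e he
          induction e using Sym2.ind with | _ a b => exact h a b ((hE _).1 he)
      rw [prod_const_one]
      by_cases h : ∀ a b, H.Adj a b → G.Adj (φ a) (φ b)
      · rw [if_pos h, if_pos (this.2 h)]
      · rw [if_neg h, if_neg fun h' => h (this.1 h')]
    rw [ha, hb]
    split_ifs <;> simp_all
  simp_rw [h1]
  rw [← sum_filter, sum_const, nsmul_eq_mul, mul_one, filter_filter,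
    labelledCopyCount_eq_natCard]
  rw [← Fintype.card_subtype, ← Nat.card_eq_fintype_card]
  congr 1
  refine Nat.card_congr
    { toFun := fun c => ⟨fun w => c w, ?_⟩
      invFun := fun φ => ⟨⟨fun w => ⟨φ.1 w, φ.2.2.1 w⟩, ?_⟩, ?_⟩
      left_inv := fun c => rfl
      right_inv := fun φ => rfl }
  · refine ⟨fun a b h => c.injective (Subtype.ext h), fun w => (c w).2, fun a b hab => ?_⟩
    exact c.toHom.map_adj hab
  · exact fun {a b} hab => φ.2.2.2 a b hab
  · exact fun a b h => φ.2.1 (congrArg Subtype.val h)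

lemma sum_perm_prod_eq (M : W → W → ℝ) :
    ∑ σ : Equiv.Perm W, ∏ w, M (σ w) w =
      ∑ I : Finset W, (-1) ^ #(univ \ I) * ∏ w, ∑ i ∈ I, M i w := by
  classical
  have h1 : ∀ I : Finset W, ∏ w, ∑ i ∈ I, M i w =
      ∑ τ : W → W, if ∀ w, τ w ∈ I then ∏ w, M (τ w) w else 0 := by
    intro I
    rw [prod_univ_sum, ← sum_filter]
    refine sum_congr ?_ fun _ _ => rfl
    ext τ
    simp
  -- inclusion-exclusion selects the surjective maps
  have h2 : ∀ τ : W → W, ∑ I : Finset W, (-1 : ℝ) ^ #(univ \ I) * (if ∀ w, τ w ∈ I then 1 else 0) =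
      if Surjective τ then 1 else 0 := by
    intro τ
    have h := prod_add (fun _ : W => (1 : ℝ)) (fun i => if ∃ w, τ w = i then 0 else -1) univ
    rw [powerset_univ] at h
    have h3 : ∏ i : W, ((1 : ℝ) + if ∃ w, τ w = i then 0 else -1) =
        if Surjective τ then 1 else 0 := by
      have : ∀ i : W, ((1 : ℝ) + if ∃ w, τ w = i then 0 else -1) =
          if ∃ w, τ w = i then 1 else 0 := by
        intro i
        split_ifs <;> simp
      simp_rw [this]
      rw [Finset.prod_ite_zero]
      simp only [mem_univ, true_implies, prod_const_one]
      exact if_congr Iff.rfl rfl rfl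
    rw [← h3, h]
    refine sum_congr rfl fun I _ => ?_
    rw [prod_const_one, one_mul]
    split_ifs with hI
    · rw [mul_one, prod_congr rfl (g := fun _ => (-1 : ℝ)), prod_const]
      intro i hi
      rw [if_neg]
      rintro ⟨w, rfl⟩
      exact (mem_sdiff.1 hi).2 (hI w)
    · push Not at hI
      obtain ⟨w, hw⟩ := hI
      rw [mul_zero, prod_eq_zero (i := τ w) (by simp [hw])]
      rw [if_pos ⟨w, rfl⟩]
  simp_rw [h1, mul_sum]
  rw [sum_comm]
  have h4 : ∀ τ : W → W, ∑ I : Finset W, (-1 : ℝ) ^ #(univ \ I) *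
      (if ∀ w, τ w ∈ I then ∏ w, M (τ w) w else 0) =
        if Surjective τ then ∏ w, M (τ w) w else 0 := by
    intro τ
    have := congrArg (· * ∏ w, M (τ w) w) (h2 τ)
    simp only [sum_mul, mul_assoc, ite_mul, one_mul, zero_mul] at this
    exact this
  simp_rw [h4]
  rw [← sum_filter]
  refine sum_bij (fun σ _ => (σ : W → W)) (fun σ _ => by simpa using σ.surjective)
    (fun σ _ τ _ h => Equiv.coe_fn_injective h) (fun τ hτ => ?_) (fun _ _ => rfl)
  have hs : Surjective τ := (mem_filter.1 hτ).2
  exact ⟨Equiv.ofBijective τ ⟨Finite.injective_iff_surjective.2 hs, hs⟩, mem_univ _, rfl⟩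

open Classical in
lemma expect_not_injective_le [Nonempty V] :
    𝔼 φ : W → V, (if Injective φ then (0 : ℝ) else 1) ≤
      (Fintype.card W : ℝ) ^ 2 * (1 / Fintype.card V) := by
  calc 𝔼 φ : W → V, (if Injective φ then (0 : ℝ) else 1)
      ≤ 𝔼 φ : W → V, ∑ i, ∑ j, if i ≠ j ∧ φ i = φ j then (1 : ℝ) else 0 := by
        refine expect_le_expect fun φ _ => ?_
        split_ifs with h
        · positivity
        · simp only [Injective, not_forall] at h
          obtain ⟨i, j, h, hij⟩ := h
          refine le_trans ?_ (single_le_sum (fun i _ => by positivity) (mem_univ i))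
          refine le_trans ?_ (single_le_sum (fun j _ => by positivity) (mem_univ j))
          rw [if_pos ⟨hij, h⟩]
    _ = ∑ i, ∑ j, 𝔼 φ : W → V, if i ≠ j ∧ φ i = φ j then (1 : ℝ) else 0 := by
        rw [expect_sum_comm]
        exact sum_congr rfl fun i _ => expect_sum_comm _ _ _
    _ ≤ ∑ _i : W, ∑ _j : W, 1 / (Fintype.card V : ℝ) := by
        refine sum_le_sum fun i _ => sum_le_sum fun j _ => ?_
        by_cases hij : i = j
        · simp [hij]
        · rw [expect_update i]
          refine expect_le univ_nonempty fun φ _ => ?_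
          simp only [update_self, update_of_ne (Ne.symm hij), ne_eq, hij, not_false_eq_true,
            true_and]
          rw [Fintype.expect_eq_sum_div_card]
          simp
    _ = (Fintype.card W : ℝ) ^ 2 * (1 / Fintype.card V) := by
        simp [pow_two, mul_assoc]

section Transfer

open Classical

/-- The deviation of the indicator that `φ` is a homomorphism from its expected value. -/
noncomputable def homDeviation (H : SimpleGraph W) (G : SimpleGraph V) (p : ℝ) (φ : W → V) : ℝ :=
  ∏ e ∈ H.edgeFinset, adjKernel G (e.map φ) - p ^ #H.edgeFinset

lemma abs_homDeviation_le (H : SimpleGraph W) (G : SimpleGraph V) {p : ℝ} (hp0 : 0 ≤ p)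
    (hp1 : p ≤ 1) (φ : W → V) : |homDeviation H G p φ| ≤ 1 := by
  have h1 : 0 ≤ ∏ e ∈ H.edgeFinset, adjKernel G (e.map φ) :=
    prod_nonneg fun e _ => adjKernel_nonneg G _
  have h2 : ∏ e ∈ H.edgeFinset, adjKernel G (e.map φ) ≤ 1 :=
    prod_le_one (fun e _ => adjKernel_nonneg G _) fun e _ => adjKernel_le_one G _
  have h3 : 0 ≤ p ^ #H.edgeFinset := pow_nonneg hp0 _
  have h4 : p ^ #H.edgeFinset ≤ 1 := pow_le_one₀ hp0 hp1
  rw [homDeviation, abs_le]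
  constructor <;> linarith

/-- The deviation of the number of copies of `H` with vertex weight `g`. Only injective maps are
counted, so that it is affine in each value of `g`. -/
noncomputable def copyDeviation (H : SimpleGraph W) (G : SimpleGraph V) (p : ℝ) (g : V → ℝ) : ℝ :=
  𝔼 φ : W → V, if Injective φ then (∏ w, g (φ w)) * homDeviation H G p φ else 0

variable [Nonempty V] {H : SimpleGraph W} {G : SimpleGraph V} {p δ : ℝ}

lemma abs_copyDeviation_indicator_le (hp0 : 0 ≤ p) (hp1 : p ≤ 1)
    (h : HereditaryCopyCount H G p δ) (S : Finset V) :
    |copyDeviation H G p fun x => if x ∈ S then 1 else 0| ≤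
      δ + (Fintype.card W : ℝ) ^ 2 * (1 / Fintype.card V) := by
  have hn : (0 : ℝ) < (Fintype.card V : ℝ) ^ Fintype.card W := by
    have : (0 : ℝ) < Fintype.card V := Nat.cast_pos.2 Fintype.card_pos
    positivity
  have hm : H.edgeSet.ncard = #H.edgeFinset := by
    rw [← SimpleGraph.coe_edgeFinset, Set.ncard_coe_finset]
  have h1 := h S
  rw [labelledCopyCount_induce G H S (E := H.edgeFinset) fun _ => SimpleGraph.mem_edgeFinset,
    hm] at h1
  have h2 : (#S : ℝ) ^ Fintype.card W = ∑ φ : W → V, ∏ w, if φ w ∈ S then (1 : ℝ) else 0 := by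
    have := prod_univ_sum (fun _ : W => (univ : Finset V)) (fun _ x => if x ∈ S then (1 : ℝ) else 0)
    rw [Fintype.piFinset_univ] at this
    rw [← this]
    simp
  have h3 : (copyDeviation H G p fun x => if x ∈ S then 1 else 0) =
      (∑ φ : W → V with Injective φ, (∏ w, if φ w ∈ S then (1 : ℝ) else 0) *
        ∏ e ∈ H.edgeFinset, adjKernel G (e.map φ) - p ^ #H.edgeFinset * (#S : ℝ) ^ Fintype.card W) /
          (Fintype.card V : ℝ) ^ Fintype.card W + 𝔼 φ : W → V, if Injective φ then 0 else
            p ^ #H.edgeFinset * ∏ w, if φ w ∈ S then (1 : ℝ) else 0 := by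
    rw [copyDeviation, Fintype.expect_eq_sum_div_card, Fintype.expect_eq_sum_div_card,
      Fintype.card_fun, Nat.cast_pow, ← add_div, h2, sum_filter, mul_sum, ← sum_sub_distrib,
      ← sum_add_distrib]
    congr 1
    refine sum_congr rfl fun φ _ => ?_
    split_ifs
    · rw [homDeviation]
      ring
    · ring
  rw [h3]
  refine (abs_add_le _ _).trans (add_le_add ?_ ((abs_expect_le _ _).trans
    ((expect_le_expect fun φ _ => ?_).trans expect_not_injective_le)))
  · rw [abs_div, abs_of_pos hn, div_le_iff₀ hn]
    exact h1
  · split_ifs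
    · simp
    · refine abs_mul_le_one ?_ (abs_prod_le_one _ fun w _ => ?_)
      · rw [abs_of_nonneg (pow_nonneg hp0 _)]
        exact pow_le_one₀ hp0 hp1
      · split_ifs <;> simp

/-- A weight with values in `[0, 1]` is an average of indicators of random sets. -/
lemma abs_copyDeviation_le {δ : ℝ} (h : ∀ S : Finset V,
      |copyDeviation H G p fun x => if x ∈ S then 1 else 0| ≤ δ)
    {g : V → ℝ} (hg0 : ∀ x, 0 ≤ g x) (hg1 : ∀ x, g x ≤ 1) : |copyDeviation H G p g| ≤ δ := by
  let P : Finset V → ℝ := fun S => (∏ x ∈ S, g x) * ∏ x ∈ univ \ S, (1 - g x)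
  have hP0 : ∀ S, 0 ≤ P S := fun S => mul_nonneg (prod_nonneg fun x _ => hg0 x)
    (prod_nonneg fun x _ => sub_nonneg.2 (hg1 x))
  have hP1 : ∑ S, P S = 1 := by
    have := prod_add g (fun x => 1 - g x) univ
    rw [powerset_univ] at this
    rw [← this]
    simp
  have hprod : ∀ φ : W → V, Injective φ →
      ∏ w, g (φ w) = ∑ S, P S * ∏ w, if φ w ∈ S then (1 : ℝ) else 0 := by
    intro φ hφ
    have h1 := prod_add g (fun x => if x ∈ univ.image φ then 0 else 1 - g x) univ
    rw [powerset_univ] at h1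
    have h2 : ∏ x, (g x + if x ∈ univ.image φ then 0 else 1 - g x) = ∏ w, g (φ w) := by
      rw [← prod_image (s := univ) (g := φ) (f := g) fun a _ b _ hab => hφ hab]
      symm
      rw [← prod_subset (subset_univ (univ.image φ))]
      · refine prod_congr rfl fun x hx => ?_
        rw [if_pos hx, add_zero]
      · intro x _ hx
        rw [if_neg hx]
        ring
    rw [← h2, h1]
    refine sum_congr rfl fun S _ => ?_
    rw [mul_assoc]
    congr 1
    rw [Finset.prod_ite_zero]
    simp only [mem_univ, true_implies, prod_const_one]
    split_ifs with hS
    · rw [mul_one]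
      refine prod_congr rfl fun x hx => if_neg fun hx' => ?_
      obtain ⟨w, _, rfl⟩ := mem_image.1 hx'
      exact (mem_sdiff.1 hx).2 (hS w)
    · push Not at hS
      obtain ⟨w, hw⟩ := hS
      rw [mul_zero]
      exact prod_eq_zero (i := φ w) (by simp [hw]) (if_pos (mem_image_of_mem _ (mem_univ _)))
  have hsum : copyDeviation H G p g =
      ∑ S, P S * copyDeviation H G p fun x => if x ∈ S then 1 else 0 := by
    simp_rw [copyDeviation, mul_expect]
    rw [← expect_sum_comm]
    refine expect_congr rfl fun φ _ => ?_
    split_ifs with hφ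
    · rw [hprod φ hφ, sum_mul]
      exact sum_congr rfl fun S _ => by ring
    · simp
  rw [hsum]
  calc |∑ S, P S * copyDeviation H G p fun x => if x ∈ S then 1 else 0|
      ≤ ∑ S, P S * δ := by
        refine (abs_sum_le_sum_abs _ _).trans (sum_le_sum fun S _ => ?_)
        rw [abs_mul, abs_of_nonneg (hP0 S)]
        exact mul_le_mul_of_nonneg_left (h S) (hP0 S)
    _ = δ := by rw [← sum_mul, hP1, one_mul]

lemma expect_weightedHom_image_sub_eq (H : SimpleGraph W) (G : SimpleGraph V) (p : ℝ)
    (u : W → V → ℝ) (σ : Equiv.Perm W) :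
    𝔼 φ, weightedHom (adjKernel G) u (H.edgeFinset.image (Sym2.map σ)) φ -
      p ^ #H.edgeFinset * ∏ w, 𝔼 x, u w x =
        𝔼 φ : W → V, (∏ w, u (σ w) (φ w)) * homDeviation H G p φ := by
  rw [← expect_prod, mul_expect, ← expect_sub_distrib]
  refine Fintype.expect_equiv (σ.symm.arrowCongr (Equiv.refl V)) _ _ fun φ => ?_
  have h1 : ∏ w, u (σ w) (σ.symm.arrowCongr (Equiv.refl V) φ w) = ∏ w, u w (φ w) := by
    rw [← Equiv.prod_comp σ fun w => u w (φ w)]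
    rfl
  rw [h1, weightedHom, homDeviation, prod_image fun a _ b _ h => Sym2.map.injective σ.injective h]
  simp_rw [Sym2.map_map]
  have h2 : (σ.symm.arrowCongr (Equiv.refl V) φ : W → V) = φ ∘ σ := rfl
  rw [h2]
  ring

/-- Polarization: the weighted counts with different weights at the different vertices are
combinations of the counts with a single weight. -/
lemma abs_sum_expect_weightedHom_le (hp0 : 0 ≤ p) (hp1 : p ≤ 1) [Nonempty W] {δ : ℝ}
    (h : ∀ g : V → ℝ, (∀ x, 0 ≤ g x) → (∀ x, g x ≤ 1) → |copyDeviation H G p g| ≤ δ)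
    {u : W → V → ℝ} (hu0 : ∀ w x, 0 ≤ u w x) (hu1 : ∀ w x, u w x ≤ 1) :
    |∑ σ : Equiv.Perm W, (𝔼 φ, weightedHom (adjKernel G) u (H.edgeFinset.image (Sym2.map σ)) φ -
      p ^ #H.edgeFinset * ∏ w, 𝔼 x, u w x)| ≤
        2 ^ Fintype.card W * ((Fintype.card W : ℝ) ^ Fintype.card W * δ) +
          Fintype.card (Equiv.Perm W) * ((Fintype.card W : ℝ) ^ 2 * (1 / Fintype.card V)) := by
  set r : ℝ := (Fintype.card W : ℝ) with hr
  have hr0 : 0 < r := Nat.cast_pos.2 Fintype.card_pos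
  simp_rw [expect_weightedHom_image_sub_eq]
  have hsplit : ∑ σ : Equiv.Perm W, 𝔼 φ : W → V, (∏ w, u (σ w) (φ w)) * homDeviation H G p φ =
      ∑ I : Finset W, (-1) ^ #(univ \ I) *
        (r ^ Fintype.card W * copyDeviation H G p fun x => (∑ i ∈ I, u i x) / r) +
      ∑ σ : Equiv.Perm W, 𝔼 φ : W → V,
        if Injective φ then 0 else (∏ w, u (σ w) (φ w)) * homDeviation H G p φ := by
    have h1 : ∑ I : Finset W, (-1) ^ #(univ \ I) *
        (r ^ Fintype.card W * copyDeviation H G p fun x => (∑ i ∈ I, u i x) / r) =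
        ∑ σ : Equiv.Perm W, 𝔼 φ : W → V,
          if Injective φ then (∏ w, u (σ w) (φ w)) * homDeviation H G p φ else 0 := by
      simp_rw [copyDeviation, mul_expect]
      rw [← expect_sum_comm, ← expect_sum_comm]
      refine expect_congr rfl fun φ _ => ?_
      split_ifs
      · rw [← sum_mul, sum_perm_prod_eq fun i w => u i (φ w), sum_mul]
        refine sum_congr rfl fun I _ => ?_
        rw [prod_div_distrib, prod_const, card_univ]
        field_simp
      · simp
    rw [h1, ← sum_add_distrib]
    refine sum_congr rfl fun σ _ => ?_
    rw [← expect_add_distrib]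
    refine expect_congr rfl fun φ _ => ?_
    split_ifs <;> ring
  rw [hsplit]
  refine (abs_add_le _ _).trans (add_le_add ?_ ?_)
  · refine (abs_sum_le_sum_abs _ _).trans ((sum_le_card_nsmul univ _
      (r ^ Fintype.card W * δ) fun I _ => ?_).trans ?_)
    · rw [abs_mul, abs_pow, abs_neg, abs_one, one_pow, one_mul, abs_mul, abs_of_pos (by positivity)]
      refine mul_le_mul_of_nonneg_left (h _ (fun x => ?_) fun x => ?_) (by positivity)
      · exact div_nonneg (sum_nonneg fun i _ => hu0 i x) hr0.le
      · rw [div_le_one hr0]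
        refine (sum_le_card_nsmul I _ 1 fun i _ => hu1 i x).trans ?_
        rw [nsmul_eq_mul, mul_one, hr]
        exact_mod_cast card_le_univ I
    · rw [card_univ, Fintype.card_finset, nsmul_eq_mul]
      push_cast
      exact le_rfl
  · refine (abs_sum_le_sum_abs _ _).trans ((sum_le_card_nsmul univ _
      (r ^ 2 * (1 / Fintype.card V)) fun σ _ => ?_).trans ?_)
    · refine (abs_expect_le _ _).trans ((expect_le_expect fun φ _ => ?_).trans
        expect_not_injective_le)
      split_ifs
      · simp
      · refine abs_mul_le_one (abs_prod_le_one _ fun w _ => ?_) (abs_homDeviation_le H G hp0 hp1 φ)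
        rw [abs_of_nonneg (hu0 _ _)]
        exact hu1 _ _
    · rw [card_univ, nsmul_eq_mul]

/-- A multilinear quantity that is at most `δ` for weights in `[0, 1]` is at most a constant times
`δ` for weights in `[-1, 1]`: write `u = 2 h - 1` and expand. -/
lemma symmetricCount_of_nonneg {E : Finset (Sym2 W)} {A : Sym2 V → ℝ} {δ : ℝ}
    (h : ∀ u : W → V → ℝ, (∀ w x, 0 ≤ u w x) → (∀ w x, u w x ≤ 1) →
      |∑ σ : Equiv.Perm W, (𝔼 φ, weightedHom A u (E.image (Sym2.map σ)) φ -
        p ^ #E * ∏ w, 𝔼 x, u w x)| ≤ δ) :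
    SymmetricCount E p (4 ^ Fintype.card W * δ) A := by
  intro u hu
  let v : Finset W → W → V → ℝ := fun J w x => if w ∈ J then (u w x + 1) / 2 else 1
  have hv0 : ∀ J w x, 0 ≤ v J w x := by
    intro J w x
    dsimp only [v]
    split_ifs
    · linarith [(abs_le.1 (hu w x)).1]
    · exact zero_le_one
  have hv1 : ∀ J w x, v J w x ≤ 1 := by
    intro J w x
    dsimp only [v]
    split_ifs
    · linarith [(abs_le.1 (hu w x)).2]
    · exact le_rfl
  have hδ : 0 ≤ δ := (abs_nonneg _).trans (h (fun _ _ => 1) (by simp) (by simp))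
  let c : Finset W → ℝ := fun J => 2 ^ #J * (-1) ^ #(univ \ J)
  have hc : ∀ J, |c J| ≤ 2 ^ Fintype.card W := by
    intro J
    rw [abs_mul, abs_pow, abs_pow, abs_neg, abs_one, one_pow, mul_one, abs_two]
    exact pow_le_pow_right₀ (by norm_num) (card_le_univ J)
  have hexp : ∀ φ : W → V, ∏ w, u w (φ w) = ∑ J, c J * ∏ w, v J w (φ w) := by
    intro φ
    have h1 := prod_add (fun w => 2 * ((u w (φ w) + 1) / 2)) (fun _ => (-1 : ℝ)) univ
    rw [powerset_univ] at h1
    rw [prod_congr rfl (g := fun w => 2 * ((u w (φ w) + 1) / 2) + -1) fun w _ => by ring, h1]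
    refine sum_congr rfl fun J _ => ?_
    rw [prod_mul_distrib, prod_const, prod_const, prod_ite_mem, univ_inter]
    ring
  have hterm : ∀ σ : Equiv.Perm W, 𝔼 φ, weightedHom A u (E.image (Sym2.map σ)) φ -
      p ^ #E * ∏ w, 𝔼 x, u w x = ∑ J, c J * (𝔼 φ, weightedHom A (v J) (E.image (Sym2.map σ)) φ -
        p ^ #E * ∏ w, 𝔼 x, v J w x) := by
    intro σ
    simp_rw [← expect_prod, mul_sub, sum_sub_distrib, mul_expect]
    rw [← expect_sum_comm, ← expect_sum_comm]
    congr 1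
    · refine expect_congr rfl fun φ _ => ?_
      rw [weightedHom, hexp, sum_mul]
      exact sum_congr rfl fun J _ => by rw [weightedHom]; ring
    · refine expect_congr rfl fun φ _ => ?_
      rw [hexp, mul_sum]
      exact sum_congr rfl fun J _ => by ring
  simp_rw [hterm]
  rw [sum_comm]
  simp_rw [← mul_sum]
  refine (abs_sum_le_sum_abs _ _).trans ((sum_le_card_nsmul univ _
    (2 ^ Fintype.card W * δ) fun J _ => ?_).trans ?_)
  · rw [abs_mul]
    exact mul_le_mul (hc J) (h (v J) (hv0 J) (hv1 J)) (abs_nonneg _) (by positivity)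
  · rw [card_univ, Fintype.card_finset, nsmul_eq_mul]
    push_cast
    rw [← mul_assoc, ← mul_pow]
    norm_num

/-- The hereditary copy count implies the symmetrised count property of the adjacency kernel, up to
an error of order `1 / n` from maps that are not injective. -/
lemma exists_symmetricCount (W : Type v) [Fintype W] [DecidableEq W] [Nonempty W] :
    ∃ C : ℝ, 0 < C ∧ ∀ (H : SimpleGraph W) (V : Type u) [Fintype V] [Nonempty V]
      (G : SimpleGraph V) (p δ : ℝ), 0 ≤ p → p ≤ 1 → 0 ≤ δ → HereditaryCopyCount H G p δ →
        SymmetricCount H.edgeFinset p (C * (δ + 1 / Fintype.card V)) (adjKernel G) := by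
  set r : ℝ := (Fintype.card W : ℝ) with hr
  set N : ℝ := (Fintype.card (Equiv.Perm W) : ℝ) with hN
  have hr0 : 0 < r := Nat.cast_pos.2 Fintype.card_pos
  have hN0 : 0 < N := Nat.cast_pos.2 Fintype.card_pos
  set D : ℝ := 2 ^ Fintype.card W * r ^ Fintype.card W with hD
  have hD0 : 0 < D := by positivity
  refine ⟨4 ^ Fintype.card W * (D * (1 + r ^ 2) + N * r ^ 2), by positivity, ?_⟩
  intro H V _ _ G p δ hp0 hp1 hδ h
  have h1 := symmetricCount_of_nonneg (fun u hu0 hu1 => abs_sum_expect_weightedHom_le hp0 hp1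
    (fun g hg0 hg1 => abs_copyDeviation_le (abs_copyDeviation_indicator_le hp0 hp1 h) hg0 hg1)
    (u := u) hu0 hu1)
  intro u hu
  refine (h1 u hu).trans ?_
  rw [mul_assoc (4 ^ _)]
  refine mul_le_mul_of_nonneg_left ?_ (by positivity)
  have ht : 0 ≤ 1 / (Fintype.card V : ℝ) := by positivity
  set t := 1 / (Fintype.card V : ℝ) with htdef
  rw [← mul_assoc, ← hD]
  have h2 : 0 ≤ D * r ^ 2 * δ := by positivity
  have h3 : 0 ≤ N * r ^ 2 * δ := by positivity
  have h4 : 0 ≤ D * t := by positivity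
  linarith

end Transfer

/-! ### The edge count -/

open Classical in
lemma hereditaryCopyCount_top_of_abs_pairing_le [Nonempty V] {G : SimpleGraph V} {p ε : ℝ}
    (h : ∀ f g : V → ℝ, (∀ x, |f x| ≤ 1) → (∀ x, |g x| ≤ 1) →
      |pairing (fun e => adjKernel G e - p) f g| ≤ ε) :
    HereditaryCopyCount (⊤ : SimpleGraph (Fin 2)) G p ε := by
  intro S
  have hn : (0 : ℝ) < (Fintype.card V : ℝ) ^ 2 := by
    have : (0 : ℝ) < Fintype.card V := Nat.cast_pos.2 Fintype.card_pos
    positivity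
  have hedge : (⊤ : SimpleGraph (Fin 2)).edgeSet = {s(0, 1)} := by
    ext e
    induction e using Sym2.ind with | _ a b =>
    fin_cases a <;> fin_cases b <;> simp
  have hncard : (⊤ : SimpleGraph (Fin 2)).edgeSet.ncard = 1 := by
    rw [hedge, Set.ncard_singleton]
  let χ : V → ℝ := fun x => if x ∈ S then 1 else 0
  have hχ : ∀ x, |χ x| ≤ 1 := fun x => by dsimp only [χ]; split_ifs <;> simp
  have hcount : ((G.induce (S : Set V)).labelledCopyCount (⊤ : SimpleGraph (Fin 2)) : ℝ) =
      ∑ x, ∑ y, adjKernel G s(x, y) * (χ x * χ y) := by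
    rw [labelledCopyCount_induce G _ S (E := {s(0, 1)}) fun e => by rw [hedge]; simp]
    simp only [prod_singleton]
    rw [sum_filter, ← Fintype.sum_prod_type',
      ← (finTwoArrowEquiv V).symm.sum_comp]
    refine sum_congr rfl fun z _ => ?_
    obtain ⟨x, y⟩ := z
    have hval : (∏ w : Fin 2, if (finTwoArrowEquiv V).symm (x, y) w ∈ S then (1 : ℝ) else 0) *
        adjKernel G (s(0, 1).map ((finTwoArrowEquiv V).symm (x, y))) =
        adjKernel G s(x, y) * (χ x * χ y) := by
      rw [Fin.prod_univ_two, mul_comm]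
      rfl
    rw [hval]
    split_ifs with hinj
    · rfl
    · -- a map that is not injective is no homomorphism, since there are no loops
      have hxy : x = y := by
        by_contra hne
        refine hinj fun a b hab => ?_
        fin_cases a <;> fin_cases b <;> simp_all [finTwoArrowEquiv]
      subst hxy
      simp [adjKernel]
  have hS : (#S : ℝ) = ∑ x, χ x := by simp [χ]
  have hmain : ((G.induce (S : Set V)).labelledCopyCount (⊤ : SimpleGraph (Fin 2)) : ℝ) -
      p ^ (⊤ : SimpleGraph (Fin 2)).edgeSet.ncard * (#S : ℝ) ^ Fintype.card (Fin 2) =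
        pairing (fun e => adjKernel G e - p) χ χ * (Fintype.card V : ℝ) ^ 2 := by
    rw [hcount, hncard, pow_one, Fintype.card_fin, hS, pairing_sub_const, pairing]
    simp only [Fintype.expect_eq_sum_div_card]
    rw [← sum_div]
    field_simp
  rw [hmain, abs_mul, abs_of_pos hn, Fintype.card_fin]
  exact mul_le_mul_of_nonneg_right (h χ χ hχ hχ) hn.le

lemma hereditaryCopyCount_mono {H : SimpleGraph W} {G : SimpleGraph V} {p δ δ' : ℝ}
    (h : HereditaryCopyCount H G p δ) (hδ : δ ≤ δ') : HereditaryCopyCount H G p δ' :=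
  fun S => (h S).trans (mul_le_mul_of_nonneg_right hδ (by positivity))

lemma hereditaryCopyCount_of_iso {W' : Type*} [Fintype W'] {H : SimpleGraph W}
    {H' : SimpleGraph W'} (e : H ≃g H') {G : SimpleGraph V} {p δ : ℝ}
    (h : HereditaryCopyCount H G p δ) : HereditaryCopyCount H' G p δ := by
  classical
  intro S
  have h1 := h S
  have h2 : (G.induce (S : Set V)).labelledCopyCount H' =
      (G.induce (S : Set V)).labelledCopyCount H := by
    rw [labelledCopyCount_eq_natCard, labelledCopyCount_eq_natCard]
    exact Nat.card_congr
      { toFun := fun c => c.comp e.toCopy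
        invFun := fun c => c.comp e.symm.toCopy
        left_inv := fun c => by ext w; simp
        right_inv := fun c => by ext w; simp }
  have h3 : H'.edgeSet.ncard = H.edgeSet.ncard := by
    rw [← Nat.card_coe_set_eq, ← Nat.card_coe_set_eq]
    exact (Nat.card_congr e.mapEdgeSet).symm
  rw [h2, h3, ← Fintype.card_congr e.toEquiv]
  exact h1

/-- Testing the copy count on a single vertex, which contains no copy, bounds the number of vertices
from below. -/
lemma pow_le_of_hereditaryCopyCount [Nontrivial W] [Nonempty V] {H : SimpleGraph W}
    {G : SimpleGraph V} {p δ : ℝ} (hp0 : 0 ≤ p) (h : HereditaryCopyCount H G p δ) :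
    p ^ H.edgeSet.ncard ≤ δ * (Fintype.card V : ℝ) ^ Fintype.card W := by
  classical
  obtain ⟨x⟩ := ‹Nonempty V›
  obtain ⟨a, b, hab⟩ := exists_pair_ne W
  have h1 := h {x}
  have h2 : (G.induce (({x} : Finset V) : Set V)).labelledCopyCount H = 0 := by
    rw [SimpleGraph.labelledCopyCount_eq_zero]
    rintro ⟨c⟩
    refine hab (c.injective (Subtype.ext ?_))
    have ha := (c a).2
    have hb := (c b).2
    simp only [coe_singleton, Set.mem_singleton_iff] at ha hb
    exact ha.trans hb.symm
  rw [h2, card_singleton, Nat.cast_zero, Nat.cast_one, one_pow, mul_one, zero_sub, abs_neg,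
    abs_of_nonneg (pow_nonneg hp0 _)] at h1
  exact h1

/-- The theorem for a fixed graph `H`, with exponent the number of vertices of `H`. -/
theorem exists_hereditaryCopyCount_top [Nonempty W] {p : ℝ} (hp0 : 0 < p) (hp1 : p ≤ 1)
    (H : SimpleGraph W) (hH : H ≠ ⊥) :
    ∃ c' : ℝ, 0 < c' ∧ ∀ ε : ℝ, 0 < ε → ε ≤ 1 → ∀ (V : Type u) [Fintype V] (G : SimpleGraph V),
      HereditaryCopyCount H G p (c' * ε ^ Fintype.card W) →
        HereditaryCopyCount (⊤ : SimpleGraph (Fin 2)) G p ε := by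
  classical
  obtain ⟨a, b, hab⟩ := SimpleGraph.ne_bot_iff_exists_adj.1 hH
  have : Nontrivial W := ⟨a, b, hab.ne⟩
  have hE : ∀ e ∈ H.edgeFinset, ¬ e.IsDiag := fun e he =>
    H.not_isDiag_of_mem_edgeSet (SimpleGraph.mem_edgeFinset.1 he)
  have hne : H.edgeFinset.Nonempty := ⟨s(a, b), by simpa using hab⟩
  obtain ⟨C, η, hC, hη, hboot⟩ := exists_abs_pairing_le_of_abs_pairing_le.{u} hE hne hp0 hp1
  obtain ⟨δ₀, hδ₀, hqual⟩ := exists_forall_abs_pairing_le.{u} hE hne hp0 hp1 hη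
  obtain ⟨D, hD, hsymm⟩ := exists_symmetricCount.{u} W
  -- with `δ = p ^ m * (β * ε) ^ r`, both `δ` and `1 / n` are at most `β * ε`
  set β : ℝ := min (1 : ℝ) (min (δ₀ / (2 * D)) (1 / (2 * D * C))) with hβ
  have hβ0 : 0 < β := by positivity
  have hβ1 : β ≤ 1 := min_le_left _ _
  have hβ2 : β ≤ δ₀ / (2 * D) := (min_le_right _ _).trans (min_le_left _ _)
  have hβ3 : β ≤ 1 / (2 * D * C) := (min_le_right _ _).trans (min_le_right _ _)
  set m := H.edgeSet.ncard with hm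
  set r := Fintype.card W with hr
  have hr0 : r ≠ 0 := Fintype.card_ne_zero
  have hpm : 0 < p ^ m := pow_pos hp0 _
  refine ⟨p ^ m * β ^ r, by positivity, ?_⟩
  intro ε hε0 hε1 V _ G hG
  rcases isEmpty_or_nonempty V with hV | hV
  · intro S
    have hS : S = ∅ := Finset.eq_empty_of_isEmpty S
    subst hS
    have h0 : (G.induce ((∅ : Finset V) : Set V)).labelledCopyCount
        (⊤ : SimpleGraph (Fin 2)) = 0 := by
      rw [SimpleGraph.labelledCopyCount_eq_zero]
      rintro ⟨c⟩
      exact hV.elim (c 0).1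
    rw [h0]
    simp
  have hβε : 0 < β * ε := mul_pos hβ0 hε0
  rw [mul_assoc, ← mul_pow] at hG
  have hn : (0 : ℝ) < Fintype.card V := Nat.cast_pos.2 Fintype.card_pos
  have h1 : 1 / (Fintype.card V : ℝ) ≤ β * ε := by
    have h := pow_le_of_hereditaryCopyCount hp0.le hG
    rw [mul_assoc, ← mul_pow] at h
    have h' : 1 ≤ (β * ε * Fintype.card V) ^ r := le_of_mul_le_mul_left (by rwa [mul_one]) hpm
    rw [div_le_iff₀ hn]
    exact (one_le_pow_iff_of_nonneg (by positivity) hr0).1 h'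
  have h2 : p ^ m * (β * ε) ^ r ≤ β * ε :=
    (mul_le_of_le_one_left (by positivity) (pow_le_one₀ hp0.le hp1)).trans
      (pow_le_of_le_one hβε.le (mul_le_one₀ hβ1 hε0.le hε1) hr0)
  have hsym := hsymm H V G p _ hp0.le hp1 (by positivity) hG
  set δ := D * (p ^ m * (β * ε) ^ r + 1 / (Fintype.card V : ℝ)) with hδ
  have hδβ : δ ≤ 2 * D * β * ε := by
    have : δ ≤ D * (β * ε + β * ε) := mul_le_mul_of_nonneg_left (add_le_add h2 h1) hD.le
    linarith
  have hδδ : δ ≤ δ₀ := by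
    have h3 := (le_div_iff₀ (by positivity)).1 hβ2
    have h4 : 2 * D * β * ε ≤ 2 * D * β := mul_le_of_le_one_right (by positivity) hε1
    linarith
  refine hereditaryCopyCount_top_of_abs_pairing_le fun f g hf hg => ?_
  refine (hboot V (adjKernel G) (adjKernel_nonneg G) (adjKernel_le_one G) δ hsym
    (hqual V (adjKernel G) (adjKernel_nonneg G) (adjKernel_le_one G) δ hδδ hsym) f g hf hg).trans ?_
  have h5 := (le_div_iff₀ (by positivity)).1 hβ3
  calc C * δ ≤ C * (2 * D * β * ε) := mul_le_mul_of_nonneg_left hδβ hC.le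
    _ = β * (2 * D * C) * ε := by ring
    _ ≤ 1 * ε := mul_le_mul_of_nonneg_right h5 hε0.le
    _ = ε := one_mul ε

end HereditaryCounts

theorem theorem2 (p : ℝ) (hp0 : 0 < p) (hp1 : p < 1) (r : ℕ) (hr : 3 ≤ r) :
    ∃ c c' : ℝ, 0 < c ∧ 0 < c' ∧
      ∀ (W : Type*) [Fintype W] (H : SimpleGraph W), Fintype.card W = r → H ≠ ⊥ →
        ∀ ε : ℝ, 0 < ε → ε < 1 / 2 →
          ∀ (V : Type*) [Fintype V] (G : SimpleGraph V),
            HereditaryCopyCount H G p (c' * ε ^ c) →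
              HereditaryCopyCount (⊤ : SimpleGraph (Fin 2)) G p ε := by
  classical
  have : NeZero r := ⟨by omega⟩
  -- the constant is the smallest one over the finitely many graphs on `Fin r`
  have hex : ∀ H : SimpleGraph (Fin r), ∃ c' : ℝ, 0 < c' ∧ (H ≠ ⊥ → _) := fun H => by
    by_cases hH : H = ⊥
    · exact ⟨1, one_pos, fun h => absurd hH h⟩
    · obtain ⟨c', hc', h⟩ := HereditaryCounts.exists_hereditaryCopyCount_top hp0 hp1.le H hH
      exact ⟨c', hc', fun _ => h⟩
  choose c' hc' h using hex
  obtain ⟨H₀, hH₀⟩ := Finite.exists_min c'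
  refine ⟨r, c' H₀, by exact_mod_cast NeZero.pos r, hc' H₀, ?_⟩
  intro W _ H hW hH ε hε0 hε1 V _ G hG
  let e : W ≃ Fin r := Fintype.equivFinOfCardEq hW
  let H' : SimpleGraph (Fin r) := H.map e.toEmbedding
  have iso : H ≃g H' := SimpleGraph.Iso.map e H
  have hH' : H' ≠ ⊥ := by
    obtain ⟨a, b, hab⟩ := SimpleGraph.ne_bot_iff_exists_adj.1 hH
    exact SimpleGraph.ne_bot_iff_exists_adj.2 ⟨iso a, iso b, iso.map_adj_iff.2 hab⟩
  refine h H' hH' ε hε0 (by linarith) V G (HereditaryCounts.hereditaryCopyCount_mono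
    (HereditaryCounts.hereditaryCopyCount_of_iso iso hG) ?_)
  rw [Real.rpow_natCast, Fintype.card_fin]
  exact mul_le_mul_of_nonneg_right (hH₀ H') (by positivity)
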